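/- Let $K$ be a field of characteristic different from $2$. A bicommutative superalgebra over $K$ is a (not necessarily associative or unital) $K$-algebra $A=A_0\oplus A_1$ with $A_iA_j\subseteq A_{i+j\,(\mathrm{mod}\,2)}$ such that \[x(yz)=(-1)^{\overline{x}\,\overline{y}}\,y(xz)\quad\text{and}\quad (xy)z=(-1)^{\overline{y}\,\overline{z}}\,(xz)y\] for all homogeneous $x,y,z\in A$, where $\overline{a}\in\{0,1\}$ is the parity of $a$, i.e. $\overline{a}=i$ for $a\in A_i$. A grading of $A$ is always an algebra grading $A=\bigoplus_d A^{(d)}$, $A^{(d)}A^{(e)}\subseteq A^{(d+e)}$, with $A^{(d)}=(A^{(d)}\cap A_0)\oplus(A^{(d)}\cap A_1)$ for all $d$. Write $\mathbb N_0=\{0,1,2,\ldots\}$. (i) Let $A$ be a finitely generated bicommutative superalgebra over $K$, graded by $\mathbb N_0$. If $A^{(0)}=0$, then all components $A^{(n)}$ are finite dimensional. Whenever all components are finite dimensional, the Hilbert series of $A$ is rational of the form \[H(A,t)=\sum_{n\ge 0}\dim_K(A^{(n)})\,t^n=f(t)\prod_{i=1}^{s}\frac{1}{1-t^{d_i}},\]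 with $f(t)\in\mathbb Z[t]$, $s\ge 0$ and integers $d_i\ge 1$. (ii) Let $A$ be a bicommutative superalgebra over $K$, graded by $\mathbb N_0^p\times\mathbb N_0^q$, and let $A$ be generated by elements $a_1,\ldots,a_r$, homogeneous of multidegrees $(m_{i1},\ldots,m_{ip},n_{i1},\ldots,n_{iq})$, $i=1,\ldots,r$, such that every generator $a_i$ with $(n_{i1},\ldots,n_{iq})\neq(0,\ldots,0)$ is odd. If $A^{(0)}=0$, then all components of $A$ are finite dimensional. Whenever all components are finite dimensional, the Hilbert series of $A$ in the variables $U=(u_1,\ldots,u_p)$ and $V=(v_1,\ldots,v_q)$ has the form \[H(A,U,V)=\sum_{(k,l)\in\mathbb N_0^p\times\mathbb N_0^q}\dim_K(A^{(k,l)})\,U^kV^l=f(U,V)\prod_{i=1}^{s}\frac{1}{1-U^{d_i}},\] where $f\in\mathbb Z[U,V]$, $s\ge 0$, $d_i\in\mathbb N_0^p\setminus\{0\}$ and $U^{d}=u_1^{d_1}\cdots u_p^{d_p}$ for $d=(d_1,\ldots,d_p)$. In every such expression the polynomial $f$ satisfies \[\deg_{v_j}f\le 2\sum_{i=1}^{r}n_{ij}\qquad(j=1,\ldots,q).\]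 -/

import Mathlib

section BicommutativeSuperalgebras

variable {K A : Type*} [Field K] [NonUnitalNonAssocRing A] [Module K A]

/-- `𝒜` is an algebra grading of the (nonassociative, nonunital) algebra `A`: the vector space `A`
is the direct sum of the subspaces `𝒜 i`, and `𝒜 i * 𝒜 j ⊆ 𝒜 (i + j)`. -/
structure IsAlgGrading {ι : Type*} [DecidableEq ι] [Add ι] (𝒜 : ι → Submodule K A) : Prop where
  isInternal : DirectSum.IsInternal 𝒜
  mul_mem : ∀ ⦃i j : ι⦄ ⦃x y : A⦄, x ∈ 𝒜 i → y ∈ 𝒜 j → x * y ∈ 𝒜 (i + j)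

/-- `A`, with even part `P 0` and odd part `P 1`, is a bicommutative superalgebra:
`P` is a `ℤ/2`-grading and the super-identities of left- and right-commutativity hold. -/
structure IsBicommutativeSuperalgebra (P : ZMod 2 → Submodule K A) : Prop
    extends IsAlgGrading P where
  super_left_comm : ∀ ⦃i j : ZMod 2⦄ ⦃x y : A⦄, x ∈ P i → y ∈ P j → ∀ z : A,
    x * (y * z) = (-1 : ℤ) ^ (i.val * j.val) • (y * (x * z))
  super_right_comm : ∀ ⦃i j : ZMod 2⦄ ⦃y z : A⦄, y ∈ P i → z ∈ P j → ∀ x : A,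
    (x * y) * z = (-1 : ℤ) ^ (i.val * j.val) • ((x * z) * y)

/-- `𝒜` is a grading of the superalgebra with parity `P`: an algebra grading each of whose
components is the sum of its even and its odd part. -/
structure IsSuperalgebraGrading {ι : Type*} [DecidableEq ι] [Add ι]
    (P : ZMod 2 → Submodule K A) (𝒜 : ι → Submodule K A) : Prop
    extends IsAlgGrading 𝒜 where
  parity : ∀ d : ι, 𝒜 d ≤ (𝒜 d ⊓ P 0) ⊔ (𝒜 d ⊓ P 1)

/-- The Hilbert series `∑ dim (𝒜 n) t ^ n` of an `ℕ₀`-grading. It is only used for gradings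
with finite dimensional components. -/
noncomputable def hilbertSeries (𝒜 : ℕ → Submodule K A) : PowerSeries ℤ :=
  PowerSeries.mk fun n => (Module.finrank K (𝒜 n) : ℤ)

/-- The Hilbert series of an `ℕ₀^p × ℕ₀^q`-grading, in the variables `u_i` (`Sum.inl i`) and
`v_j` (`Sum.inr j`). It is only used for gradings with finite dimensional components. -/
noncomputable def multiHilbertSeries {p q : ℕ}
    (𝒜 : ((Fin p ⊕ Fin q) →₀ ℕ) → Submodule K A) : MvPowerSeries (Fin p ⊕ Fin q) ℤ :=
  fun d => (Module.finrank K (𝒜 d) : ℤ)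

/-- `H = f(t) ∏ 1 / (1 - t ^ d_i)` with all `d_i ≥ 1`, written without the denominators
(each factor `1 - t ^ d_i` is invertible as a power series). -/
def HasRationalForm (H : PowerSeries ℤ) (f : Polynomial ℤ) {s : ℕ} (d : Fin s → ℕ) : Prop :=
  (∀ i, 1 ≤ d i) ∧
    H * ∏ i, (1 - (PowerSeries.X : PowerSeries ℤ) ^ d i) = (f : PowerSeries ℤ)

/-- `H = f(U, V) ∏ 1 / (1 - U ^ d_i)` with nonzero exponent vectors `d_i ∈ ℕ₀^p` in the even
variables only, written without the denominators
(each factor `1 - U ^ d_i` is invertible as a power series). -/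
def HasMultiRationalForm {p q : ℕ} (H : MvPowerSeries (Fin p ⊕ Fin q) ℤ)
    (f : MvPolynomial (Fin p ⊕ Fin q) ℤ) {s : ℕ} (d : Fin s → (Fin p → ℕ)) : Prop :=
  (∀ i, d i ≠ 0) ∧
    H * ∏ i, (1 - ∏ k : Fin p, (MvPowerSeries.X (Sum.inl k)) ^ d i k)
      = (f : MvPowerSeries (Fin p ⊕ Fin q) ℤ)

end BicommutativeSuperalgebras

/-! ### Dimension counts and homogeneous subspaces of a graded vector space. -/

section GradedLinearAlgebra

open DirectSum

variable {K M : Type*} [Field K] [AddCommGroup M] [Module K M]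

/-! The square of the algebra behaves like a module over a supercommutative polynomial ring. Left
multiplications supercommute with each other, right multiplications likewise, and a left and a right
multiplication commute on products (`mul_mul_comm_of_mem`). Hence `A` is spanned by the generators
and by the words of `GeneratorWord`, on whose span `wordSpan` these operators act.

An odd multiplication operator has square zero because 2 is invertible, and an operator of degree
zero preserves each finite dimensional component. So `wordSpan` is finitely generated under the even
operators of nonzero degree alone (`exists_finiteDimensional_generating_wordSpan`). These commute,
so Hilbert's basis theorem (`maximalCondition_of_generates`) and the Hilbert–Serre induction
(`isPolynomial_subspaceHilbertSeries_sub_mul_prod`) give rationality. The quotient `A / wordSpan`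
lives in the degrees of the generators and adds a polynomial.

For the degree bound, an odd generator occurs in a nonzero word at most once on each side, and only
odd generators carry `v`-degree. So the `v_j`-degrees occurring in `A` are at most twice the sum of
the `n_ij`, and denominators in the `u`-variables do not change this. -/

theorem Submodule.finrank_map_add_finrank_inf_ker {M' : Type*} [AddCommGroup M'] [Module K M']
    (V : Submodule K M) [FiniteDimensional K V] (f : M →ₗ[K] M') :
    Module.finrank K (V.map f) + Module.finrank K (V ⊓ LinearMap.ker f : Submodule K M)
      = Module.finrank K V := by
  have h := LinearMap.finrank_range_add_finrank_ker (f.domRestrict V)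
  have h1 : LinearMap.range (f.domRestrict V) = V.map f := by
    rw [LinearMap.domRestrict, LinearMap.range_comp, Submodule.range_subtype]
  have h2 : (V ⊓ LinearMap.ker f : Submodule K M)
      = (LinearMap.ker (f.domRestrict V)).map V.subtype := by
    ext x
    simp only [Submodule.mem_inf, Submodule.mem_map, LinearMap.mem_ker, LinearMap.domRestrict_apply,
      Submodule.subtype_apply, Subtype.exists, exists_and_left, exists_prop, exists_eq_right_right]
    exact and_comm
  rw [← h, h1, h2, LinearEquiv.finrank_eq
    (Submodule.equivMapOfInjective V.subtype V.injective_subtype _).symm]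

/-- The dimension count behind the Hilbert–Serre argument: a map `T : V/V₁ → W/W₁`, with kernel
`V ⊓ T⁻¹ W₁` and image `W₁ ⊔ T V`. -/
theorem finrank_sup_map_add_finrank_inf_comap {M' : Type*} [AddCommGroup M'] [Module K M']
    (V : Submodule K M) (W : Submodule K M') [FiniteDimensional K V]
    [FiniteDimensional K W] (T : M →ₗ[K] M') :
    Module.finrank K (W ⊔ V.map T : Submodule K M')
        + Module.finrank K (V ⊓ W.comap T : Submodule K M)
      = Module.finrank K W + Module.finrank K V := by
  have h1 := Submodule.finrank_sup_add_finrank_inf_eq W (V.map T)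
  have h2 := Submodule.finrank_map_add_finrank_inf_ker V T
  have : FiniteDimensional K (V ⊓ W.comap T : Submodule K M) :=
    Submodule.finiteDimensional_of_le inf_le_left
  have h3 := Submodule.finrank_map_add_finrank_inf_ker (V ⊓ W.comap T) T
  -- Restricted to `V ⊓ W.comap T`, `T` has image `W ⊓ V.map T` and the same kernel as on `V`. The
  -- intersection term of the dimension formula for the sum is thereby eliminated.
  have h4 : (V ⊓ W.comap T).map T = W ⊓ V.map T := by
    refine le_antisymm ?_ ?_
    · rintro _ ⟨x, hx, rfl⟩
      exact ⟨hx.2, Submodule.mem_map_of_mem hx.1⟩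
    · rintro _ ⟨hx', x, hx, rfl⟩
      exact Submodule.mem_map_of_mem ⟨hx, hx'⟩
  have h5 : V ⊓ W.comap T ⊓ LinearMap.ker T = V ⊓ LinearMap.ker T := by
    rw [inf_assoc, inf_eq_right.2 (show LinearMap.ker T ≤ W.comap T from
      Submodule.comap_mono bot_le)]
  rw [h4, h5] at h3
  omega

section Homogeneous

variable {ι : Type*} [DecidableEq ι] (𝒜 : ι → Submodule K M) [Decomposition 𝒜]

/-- The projection onto a homogeneous component. -/
noncomputable def gradedProj (d : ι) : M →ₗ[K] M :=
  (𝒜 d).subtype ∘ₗ DirectSum.component K ι (fun i => 𝒜 i) d ∘ₗ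
    (decomposeLinearEquiv 𝒜).toLinearMap

theorem gradedProj_mem (d : ι) (x : M) : gradedProj 𝒜 d x ∈ 𝒜 d := (decompose 𝒜 x d).2

variable {𝒜}

theorem gradedProj_of_mem {d : ι} {x : M} (hx : x ∈ 𝒜 d) : gradedProj 𝒜 d x = x :=
  decompose_of_mem_same 𝒜 hx

theorem gradedProj_of_mem_ne {d e : ι} {x : M} (hx : x ∈ 𝒜 d) (h : d ≠ e) :
    gradedProj 𝒜 e x = 0 :=
  decompose_of_mem_ne 𝒜 hx h

variable (𝒜)

/-- A subspace is homogeneous if it contains the homogeneous components of its elements. -/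
def IsHomogeneousSubspace (N : Submodule K M) : Prop :=
  ∀ x ∈ N, ∀ d, gradedProj 𝒜 d x ∈ N

variable {𝒜}

theorem isHomogeneousSubspace_span {S : Set M} (hS : ∀ x ∈ S, ∃ d, x ∈ 𝒜 d) :
    IsHomogeneousSubspace 𝒜 (Submodule.span K S) := by
  intro x hx d
  have : Submodule.span K S ≤ (Submodule.span K S).comap (gradedProj 𝒜 d) := by
    refine Submodule.span_le.2 fun y hy => ?_
    obtain ⟨e, he⟩ := hS y hy
    rcases eq_or_ne e d with rfl | hne
    · simpa [gradedProj_of_mem he] using Submodule.subset_span hy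
    · simp [gradedProj_of_mem_ne he hne]
  exact this hx

/-- If homogeneous elements span, then the component of degree `d` is spanned by those among them
that have degree `d`. -/
theorem le_span_inter_of_span_eq_top {S : Set M} (hS : ∀ x ∈ S, ∃ d, x ∈ 𝒜 d)
    (htop : Submodule.span K S = ⊤) (d : ι) :
    𝒜 d ≤ Submodule.span K (S ∩ 𝒜 d) := by
  intro x hx
  have : Submodule.span K S ≤ (Submodule.span K (S ∩ 𝒜 d)).comap (gradedProj 𝒜 d) := by
    refine Submodule.span_le.2 fun y hy => ?_
    obtain ⟨e, he⟩ := hS y hy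
    rcases eq_or_ne e d with rfl | hne
    · simpa [gradedProj_of_mem he] using Submodule.subset_span (show y ∈ S ∩ 𝒜 e from ⟨hy, he⟩)
    · simp [gradedProj_of_mem_ne he hne]
  simpa [gradedProj_of_mem hx] using this (show x ∈ _ from htop ▸ Submodule.mem_top)

theorem IsHomogeneousSubspace.sup {N N' : Submodule K M} (h : IsHomogeneousSubspace 𝒜 N)
    (h' : IsHomogeneousSubspace 𝒜 N') : IsHomogeneousSubspace 𝒜 (N ⊔ N') := by
  intro x hx d
  obtain ⟨y, hy, z, hz, rfl⟩ := Submodule.mem_sup.1 hx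
  rw [map_add]
  exact Submodule.add_mem_sup (h y hy d) (h' z hz d)

theorem IsHomogeneousSubspace.sup_inf {N N' : Submodule K M} (h : IsHomogeneousSubspace 𝒜 N)
    (h' : IsHomogeneousSubspace 𝒜 N') (d : ι) : (N ⊔ N') ⊓ 𝒜 d = N ⊓ 𝒜 d ⊔ N' ⊓ 𝒜 d := by
  refine le_antisymm ?_ (le_inf (sup_le_sup inf_le_left inf_le_left)
    (sup_le inf_le_right inf_le_right))
  rintro x ⟨hx, hxd⟩
  obtain ⟨y, hy, z, hz, rfl⟩ := Submodule.mem_sup.1 hx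
  rw [← gradedProj_of_mem hxd, map_add]
  exact Submodule.add_mem_sup ⟨h y hy d, gradedProj_mem 𝒜 d y⟩ ⟨h' z hz d, gradedProj_mem 𝒜 d z⟩

end Homogeneous

section Operators

variable {σ : Type*} [DecidableEq σ] {𝒜 : (σ →₀ ℕ) → Submodule K M} [Decomposition 𝒜]
  {T : M →ₗ[K] M} {e : σ →₀ ℕ}

theorem gradedProj_add_apply (hT : ∀ d, 𝒜 d ≤ (𝒜 (d + e)).comap T) (d : σ →₀ ℕ) (x : M) :
    gradedProj 𝒜 (d + e) (T x) = T (gradedProj 𝒜 d x) := by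
  induction x using Decomposition.inductionOn 𝒜 with
  | zero => simp
  | @homogeneous i m =>
    rcases eq_or_ne i d with rfl | h
    · rw [gradedProj_of_mem m.2, gradedProj_of_mem (show T m ∈ 𝒜 _ from hT _ m.2)]
    · rw [gradedProj_of_mem_ne m.2 h, map_zero, gradedProj_of_mem_ne (show T m ∈ 𝒜 _ from hT _ m.2)]
      exact fun h' => h (add_right_cancel h')
  | add x y hx hy => simp only [map_add, hx, hy]

theorem gradedProj_apply_of_not_le (hT : ∀ d, 𝒜 d ≤ (𝒜 (d + e)).comap T) {c : σ →₀ ℕ}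
    (hc : ¬ e ≤ c) (x : M) : gradedProj 𝒜 c (T x) = 0 := by
  induction x using Decomposition.inductionOn 𝒜 with
  | zero => simp
  | @homogeneous i m =>
    refine gradedProj_of_mem_ne (show T m ∈ 𝒜 _ from hT _ m.2) ?_
    rintro rfl
    exact hc le_add_self
  | add x y hx hy => simp only [map_add, hx, hy, add_zero]

theorem IsHomogeneousSubspace.map (hT : ∀ d, 𝒜 d ≤ (𝒜 (d + e)).comap T) {N : Submodule K M}
    (h : IsHomogeneousSubspace 𝒜 N) : IsHomogeneousSubspace 𝒜 (N.map T) := by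
  rintro _ ⟨x, hx, rfl⟩ c
  by_cases hc : e ≤ c
  · obtain ⟨d, rfl⟩ := exists_add_of_le hc
    rw [add_comm e d, gradedProj_add_apply hT]
    exact Submodule.mem_map_of_mem (h x hx d)
  · rw [gradedProj_apply_of_not_le hT hc]
    exact zero_mem _

theorem IsHomogeneousSubspace.inf_comap (hT : ∀ d, 𝒜 d ≤ (𝒜 (d + e)).comap T)
    {N N' : Submodule K M} (h : IsHomogeneousSubspace 𝒜 N) (h' : IsHomogeneousSubspace 𝒜 N') :
    IsHomogeneousSubspace 𝒜 (N ⊓ N'.comap T) := by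
  rintro x ⟨hx, hx'⟩ d
  refine ⟨h x hx d, ?_⟩
  have := h' _ hx' (d + e)
  rwa [gradedProj_add_apply hT] at this

theorem IsHomogeneousSubspace.map_inf_add (hT : ∀ d, 𝒜 d ≤ (𝒜 (d + e)).comap T)
    {N : Submodule K M} (h : IsHomogeneousSubspace 𝒜 N) (d : σ →₀ ℕ) :
    N.map T ⊓ 𝒜 (d + e) = (N ⊓ 𝒜 d).map T := by
  refine le_antisymm ?_ ?_
  · rintro _ ⟨⟨x, hx, rfl⟩, hd⟩
    rw [← gradedProj_of_mem hd, gradedProj_add_apply hT]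
    exact Submodule.mem_map_of_mem ⟨h x hx d, gradedProj_mem 𝒜 d x⟩
  · rintro _ ⟨x, ⟨hx, hd⟩, rfl⟩
    exact ⟨Submodule.mem_map_of_mem hx, hT _ hd⟩

theorem map_inf_eq_bot_of_not_le (hT : ∀ d, 𝒜 d ≤ (𝒜 (d + e)).comap T) (N : Submodule K M)
    {c : σ →₀ ℕ} (hc : ¬ e ≤ c) : N.map T ⊓ 𝒜 c = ⊥ := by
  rw [eq_bot_iff]
  rintro _ ⟨⟨x, hx, rfl⟩, hd⟩
  rw [← gradedProj_of_mem hd, gradedProj_apply_of_not_le hT hc]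
  exact zero_mem _

end Operators

end GradedLinearAlgebra

/-! ### Hilbert series of subquotients and the Hilbert–Serre induction. -/

section HilbertSerre

open DirectSum

/-- A power series is polynomial if it lies in the image of the polynomial ring. -/
def MvPowerSeries.IsPolynomial {σ : Type*} (H : MvPowerSeries σ ℤ) : Prop :=
  ∃ f : MvPolynomial σ ℤ, (f : MvPowerSeries σ ℤ) = H

namespace MvPowerSeries.IsPolynomial

variable {σ : Type*} {H H' : MvPowerSeries σ ℤ}

theorem add (h : H.IsPolynomial) (h' : H'.IsPolynomial) : (H + H').IsPolynomial := by
  obtain ⟨f, rfl⟩ := h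
  obtain ⟨g, rfl⟩ := h'
  exact ⟨f + g, MvPolynomial.coe_add f g⟩

theorem mul (h : H.IsPolynomial) (h' : H'.IsPolynomial) : (H * H').IsPolynomial := by
  obtain ⟨f, rfl⟩ := h
  obtain ⟨g, rfl⟩ := h'
  exact ⟨f * g, MvPolynomial.coe_mul f g⟩

theorem monomial (e : σ →₀ ℕ) (a : ℤ) : (MvPowerSeries.monomial e a).IsPolynomial :=
  ⟨MvPolynomial.monomial e a, MvPolynomial.coe_monomial e a⟩

theorem one : (1 : MvPowerSeries σ ℤ).IsPolynomial := ⟨1, MvPolynomial.coe_one⟩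

theorem sub (h : H.IsPolynomial) (h' : H'.IsPolynomial) : (H - H').IsPolynomial := by
  obtain ⟨f, rfl⟩ := h
  obtain ⟨g, rfl⟩ := h'
  exact ⟨f - g, map_sub MvPolynomial.coeToMvPowerSeries.ringHom f g⟩

theorem prod {κ : Type*} (s : Finset κ) (F : κ → MvPowerSeries σ ℤ)
    (h : ∀ i ∈ s, (F i).IsPolynomial) : (∏ i ∈ s, F i).IsPolynomial := by
  classical
  induction s using Finset.induction_on with
  | empty => simpa using one
  | insert a s ha ih =>
    rw [Finset.prod_insert ha]
    exact (h a (Finset.mem_insert_self _ _)).mul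
      (ih fun i hi => h i (Finset.mem_insert_of_mem hi))

theorem of_finite (h : {d | MvPowerSeries.coeff d H ≠ 0}.Finite) : H.IsPolynomial := by
  classical
  refine ⟨∑ d ∈ h.toFinset, MvPolynomial.monomial d (MvPowerSeries.coeff d H), ?_⟩
  ext d
  rw [MvPolynomial.coeff_coe, MvPolynomial.coeff_sum]
  simp only [MvPolynomial.coeff_monomial, Finset.sum_ite_eq', Set.Finite.mem_toFinset,
    Set.mem_ofPred_eq]
  split_ifs with hd
  · rfl
  · exact (not_not.1 hd).symm

end MvPowerSeries.IsPolynomial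

variable {K M : Type*} [Field K] [AddCommGroup M] [Module K M]
  {σ : Type*} (𝒜 : (σ →₀ ℕ) → Submodule K M)

/-- The Hilbert series of a homogeneous subspace. -/
noncomputable def subspaceHilbertSeries (N : Submodule K M) : MvPowerSeries σ ℤ :=
  fun d => (Module.finrank K (N ⊓ 𝒜 d : Submodule K M) : ℤ)

theorem coeff_subspaceHilbertSeries (N : Submodule K M) (d : σ →₀ ℕ) :
    MvPowerSeries.coeff d (subspaceHilbertSeries 𝒜 N)
      = (Module.finrank K (N ⊓ 𝒜 d : Submodule K M) : ℤ) := rfl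

theorem subspaceHilbertSeries_bot : subspaceHilbertSeries 𝒜 (⊥ : Submodule K M) = 0 := by
  ext d
  rw [coeff_subspaceHilbertSeries, bot_inf_eq, finrank_bot]
  simp

/-- The subspaces between `N'` and `N` that are stable under the operators `T i`, `i ∈ s`, satisfy
the maximal condition. -/
def MaximalCondition {κ : Type*} (T : κ → M →ₗ[K] M) (s : Set κ) (N' N : Submodule K M) : Prop :=
  ∀ 𝒮 : Set (Submodule K M), 𝒮.Nonempty →
    (∀ L ∈ 𝒮, N' ≤ L ∧ L ≤ N ∧ ∀ i ∈ s, L ≤ L.comap (T i)) →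
      ∃ L ∈ 𝒮, ∀ L' ∈ 𝒮, L ≤ L' → L' ≤ L

variable {𝒜}

theorem isPolynomial_subspaceHilbertSeries_sub {N' N : Submodule K M} (hle : N' ≤ N)
    (hfin : {d | ¬ N ⊓ 𝒜 d ≤ N'}.Finite) :
    (subspaceHilbertSeries 𝒜 N - subspaceHilbertSeries 𝒜 N').IsPolynomial := by
  refine .of_finite (hfin.subset fun d hd hle' => hd ?_)
  have : N ⊓ 𝒜 d = N' ⊓ 𝒜 d :=
    le_antisymm (le_inf hle' inf_le_right) (inf_le_inf_right _ hle)
  rw [map_sub, coeff_subspaceHilbertSeries, coeff_subspaceHilbertSeries, this, sub_self]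

variable [DecidableEq σ] [Decomposition 𝒜]

/-- Base case of the induction. Among the sums of `N'` with finitely many components of `N` there is
a maximal one; it absorbs every further component, and projecting to that degree puts the component
inside `N'`. -/
theorem MaximalCondition.finite {κ : Type*} {T : κ → M →ₗ[K] M} {N' N : Submodule K M}
    (h : MaximalCondition T ∅ N' N) (hle : N' ≤ N) (hN' : IsHomogeneousSubspace 𝒜 N') :
    {d | ¬ N ⊓ 𝒜 d ≤ N'}.Finite := by
  let G : Finset (σ →₀ ℕ) → Submodule K M := fun F => N' ⊔ ⨆ d ∈ F, N ⊓ 𝒜 d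
  obtain ⟨_, ⟨F, rfl⟩, hF⟩ := h (Set.range G) (Set.range_nonempty G) (by
    rintro _ ⟨F, rfl⟩
    exact ⟨le_sup_left, sup_le hle (iSup₂_le fun _ _ => inf_le_left), fun i hi => hi.elim⟩)
  refine F.finite_toSet.subset fun d hd => ?_
  by_contra hdF
  refine hd fun x hx => ?_
  have hGF : G F ≤ G (insert d F) :=
    sup_le_sup_left (biSup_mono fun i hi => Finset.mem_insert_of_mem hi) _
  have hxG : x ∈ G F := by
    refine hF _ ⟨insert d F, rfl⟩ hGF ?_
    exact (le_sup_of_le_right (le_iSup₂_of_le (f := fun d _ => N ⊓ 𝒜 d) d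
      (Finset.mem_insert_self _ _) le_rfl)) hx
  have hle2 : G F ≤ N'.comap (gradedProj 𝒜 d) := by
    refine sup_le (fun y hy => hN' y hy d) (iSup₂_le fun c hc y hy => ?_)
    have hne : c ≠ d := fun h => hdF (by simpa [h] using hc)
    simp [gradedProj_of_mem_ne hy.2 hne]
  simpa [gradedProj_of_mem hx.2] using hle2 hxG

/-- The four-term exact sequence of multiplication by `T` on `N / N'`. -/
theorem subspaceHilbertSeries_sup_map [∀ d, FiniteDimensional K (𝒜 d)] {T : M →ₗ[K] M}
    {e : σ →₀ ℕ} (hT : ∀ d, 𝒜 d ≤ (𝒜 (d + e)).comap T) {N' N : Submodule K M}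
    (hN' : IsHomogeneousSubspace 𝒜 N') (hN : IsHomogeneousSubspace 𝒜 N) :
    subspaceHilbertSeries 𝒜 (N' ⊔ N.map T) - subspaceHilbertSeries 𝒜 N'
      = MvPowerSeries.monomial e 1 *
        (subspaceHilbertSeries 𝒜 N - subspaceHilbertSeries 𝒜 (N ⊓ N'.comap T)) := by
  have hfin (L : Submodule K M) (d) : FiniteDimensional K (L ⊓ 𝒜 d : Submodule K M) :=
    Submodule.finiteDimensional_of_le inf_le_right
  ext c
  rw [MvPowerSeries.coeff_monomial_mul, map_sub, map_sub]
  simp only [coeff_subspaceHilbertSeries]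
  rw [hN'.sup_inf (hN.map hT)]
  split_ifs with hc
  · obtain ⟨d, rfl⟩ := exists_add_of_le hc
    rw [add_tsub_cancel_left, add_comm e d, hN.map_inf_add hT]
    have h1 := finrank_sup_map_add_finrank_inf_comap (N ⊓ 𝒜 d) (N' ⊓ 𝒜 (d + e)) T
    have h2 : N ⊓ 𝒜 d ⊓ (N' ⊓ 𝒜 (d + e)).comap T = N ⊓ N'.comap T ⊓ 𝒜 d := by
      ext x
      simp only [Submodule.mem_inf, Submodule.mem_comap]
      exact ⟨fun h => ⟨⟨h.1.1, h.2.1⟩, h.1.2⟩, fun h => ⟨⟨h.1.1, h.2⟩, h.1.2, hT _ h.2⟩⟩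
    rw [h2] at h1
    rw [one_mul]
    omega
  · rw [map_inf_eq_bot_of_not_le hT N hc, sup_bot_eq, sub_self]

/-- The Hilbert–Serre theorem, for a subquotient `N / N'` of a multigraded vector space on which
commuting homogeneous operators act. -/
theorem isPolynomial_subspaceHilbertSeries_sub_mul_prod [∀ d, FiniteDimensional K (𝒜 d)]
    {κ : Type*} (T : κ → M →ₗ[K] M) (e : κ → σ →₀ ℕ) (s : Finset κ)
    (hT : ∀ i ∈ s, ∀ d, 𝒜 d ≤ (𝒜 (d + e i)).comap (T i)) :
    ∀ N' N : Submodule K M, N' ≤ N → IsHomogeneousSubspace 𝒜 N' → IsHomogeneousSubspace 𝒜 N →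
      (∀ i ∈ s, N' ≤ N'.comap (T i)) → (∀ i ∈ s, N ≤ N.comap (T i)) →
      (∀ i ∈ s, ∀ j ∈ s, ∀ x ∈ N, T i (T j x) = T j (T i x)) →
      MaximalCondition T s N' N →
      ((subspaceHilbertSeries 𝒜 N - subspaceHilbertSeries 𝒜 N') *
        ∏ i ∈ s, (1 - MvPowerSeries.monomial (e i) 1)).IsPolynomial := by
  classical
  induction s using Finset.induction_on with
  | empty =>
    intro N' N hle hN' hN _ _ _ hmax
    simpa using isPolynomial_subspaceHilbertSeries_sub hle
      ((by simpa using hmax : MaximalCondition T ∅ N' N).finite hle hN')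
  | insert a s ha ih =>
    intro N' N hle hN' hN hsN' hsN hcomm hmax
    have hTa := hT a (Finset.mem_insert_self _ _)
    have hs {i} (hi : i ∈ s) : i ∈ insert a s := Finset.mem_insert_of_mem hi
    have has : a ∈ insert a s := Finset.mem_insert_self _ _
    -- Kernel of `T a` on `N / N'`. There `T a` acts as zero, so stability under `T a` is automatic
    -- and the maximal condition for `insert a s` yields the one for `s`.
    have hker := ih (fun i hi => hT i (hs hi)) N' (N ⊓ N'.comap (T a))
      (le_inf hle (hsN' a has)) hN' (hN.inf_comap hTa hN') (fun i hi => hsN' i (hs hi))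
      (fun i hi x hx => ⟨hsN i (hs hi) hx.1, by
        change T a (T i x) ∈ N'
        rw [hcomm a has i (hs hi) x hx.1]
        exact hsN' i (hs hi) hx.2⟩)
      (fun i hi j hj x hx => hcomm i (hs hi) j (hs hj) x hx.1)
      (fun 𝒮 hne h𝒮 => hmax 𝒮 hne fun L hL => by
        obtain ⟨h1, h2, h3⟩ := h𝒮 L hL
        refine ⟨h1, h2.trans inf_le_left, fun i hi => ?_⟩
        rcases Finset.mem_insert.1 hi with rfl | hi
        · exact (h2.trans inf_le_right).trans (Submodule.comap_mono h1)
        · exact h3 i hi)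
    have hmap : N.map (T a) ≤ N := Submodule.map_le_iff_le_comap.2 (hsN a has)
    -- Cokernel of `T a` on `N / N'`, where `T a` again acts as zero.
    have hcoker := ih (fun i hi => hT i (hs hi)) (N' ⊔ N.map (T a)) N
      (sup_le hle hmap) (hN'.sup (hN.map hTa)) hN
      (fun i hi => sup_le ((hsN' i (hs hi)).trans (Submodule.comap_mono le_sup_left)) (by
        rintro _ ⟨x, hx, rfl⟩
        refine Submodule.mem_sup_right ?_
        rw [hcomm i (hs hi) a has x hx]
        exact Submodule.mem_map_of_mem (hsN i (hs hi) hx)))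
      (fun i hi => hsN i (hs hi))
      (fun i hi j hj => hcomm i (hs hi) j (hs hj))
      (fun 𝒮 hne h𝒮 => hmax 𝒮 hne fun L hL => by
        obtain ⟨h1, h2, h3⟩ := h𝒮 L hL
        refine ⟨le_sup_left.trans h1, h2, fun i hi => ?_⟩
        rcases Finset.mem_insert.1 hi with rfl | hi
        · exact (h2.trans (Submodule.map_le_iff_le_comap.1 (le_sup_right.trans h1)))
        · exact h3 i hi)
    have key := subspaceHilbertSeries_sup_map hTa hN' hN
    rw [Finset.prod_insert ha]
    convert hcoker.sub ((MvPowerSeries.IsPolynomial.monomial (e a) 1).mul hker) using 1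
    linear_combination (∏ i ∈ s, (1 - MvPowerSeries.monomial (e i) (1 : ℤ))) * key

end HilbertSerre

/-! ### Subspaces stable under operators that commute, possibly up to scalars. -/

section StableSubspaces

variable {K M : Type*} [Field K] [AddCommGroup M] [Module K M] {κ : Type*}

/-- Hilbert's basis theorem: the restrictions of the operators to `N` generate a commutative
finitely generated algebra `R`, which is Noetherian. `N` is a finite `R`-module, and the stable
subspaces of `N` are its `R`-submodules. -/
theorem maximalCondition_of_generates (T : κ → M →ₗ[K] M) {s : Set κ} (hs : s.Finite)
    {N V : Submodule K M} [FiniteDimensional K V] (hst : ∀ i ∈ s, N ≤ N.comap (T i))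
    (hcomm : ∀ i ∈ s, ∀ j ∈ s, ∀ x ∈ N, T i (T j x) = T j (T i x))
    (hVN : V ≤ N)
    (hgen : ∀ L : Submodule K M, V ≤ L → (∀ i ∈ s, L ≤ L.comap (T i)) → N ≤ L) :
    MaximalCondition T s ⊥ N := by
  let t : s → Module.End K N := fun i => (T i).restrict (hst i i.2)
  have : Finite s := hs
  have htcomm : ∀ a ∈ Set.range t, ∀ b ∈ Set.range t, a * b = b * a := by
    rintro _ ⟨i, rfl⟩ _ ⟨j, rfl⟩
    ext x
    exact hcomm i i.2 j j.2 x x.2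
  let R : Subalgebra K (Module.End K N) := Algebra.adjoin K (Set.range t)
  have : IsMulCommutative (Algebra.adjoin K (Set.range t)) :=
    Algebra.isMulCommutative_adjoin K htcomm
  let _ : CommRing R := { (inferInstance : Ring R) with mul_comm := this.is_comm.comm }
  have hR : Algebra.FiniteType K R :=
    (Subalgebra.fg_iff_finiteType R).1 (Subalgebra.fg_def.2 ⟨_, Set.finite_range t, rfl⟩)
  have hnoeth : IsNoetherianRing R := Algebra.FiniteType.isNoetherianRing K R
  have hR_smul (i : s) (x : N) : (⟨t i, Algebra.subset_adjoin ⟨i, rfl⟩⟩ : R) • x = t i x := rfl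
  have hfin : Module.Finite R N := by
    obtain ⟨W, hW⟩ : (V.comap N.subtype).FG := by
      have : FiniteDimensional K (V.comap N.subtype) :=
        LinearEquiv.finiteDimensional (Submodule.comapSubtypeEquivOfLe hVN).symm
      exact Module.Finite.iff_fg.1 this
    refine ⟨⟨W, ?_⟩⟩
    rw [eq_top_iff]
    intro x _
    have hle : N ≤ ((Submodule.span R (W : Set N)).restrictScalars K).map N.subtype := by
      refine hgen _ (fun v hv => ?_) (fun i hi => ?_)
      · refine ⟨⟨v, hVN hv⟩, ?_, rfl⟩
        exact Submodule.span_le_restrictScalars K R _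
          (hW.symm ▸ (show (⟨v, hVN hv⟩ : N) ∈ V.comap N.subtype from hv))
      · rintro _ ⟨y, hy, rfl⟩
        refine ⟨t ⟨i, hi⟩ y, ?_, rfl⟩
        rw [← hR_smul ⟨i, hi⟩ y]
        exact Submodule.smul_mem (Submodule.span R (W : Set N)) _ hy
    obtain ⟨y, hy, hyx⟩ := hle x.2
    rwa [← show y = x from Subtype.ext hyx]
  intro 𝒮 hne h𝒮
  let S' : Set (Submodule R N) :=
    {L' | L'.restrictScalars K ∈ (fun L : Submodule K M => L.comap N.subtype) '' 𝒮}
  have hlift (L) (hL : L ∈ 𝒮) : ∃ L' : Submodule R N,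
      L'.restrictScalars K = L.comap N.subtype := by
    refine ⟨{ L.comap N.subtype with smul_mem' := ?_ }, rfl⟩
    rintro ⟨r, hr⟩ x hx
    change r x ∈ L.comap N.subtype
    replace hx : x ∈ L.comap N.subtype := hx
    induction hr using Algebra.adjoin_induction generalizing x with
    | mem r hr =>
      obtain ⟨i, rfl⟩ := hr
      exact (h𝒮 L hL).2.2 i i.2 hx
    | algebraMap c => exact Submodule.smul_mem _ c hx
    | add a b _ _ ha hb => exact Submodule.add_mem _ (ha hx) (hb hx)
    | mul a b _ _ ha hb => exact ha (hb hx)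
  have hS'ne : S'.Nonempty := by
    obtain ⟨L, hL⟩ := hne
    obtain ⟨L', hL'⟩ := hlift L hL
    exact ⟨L', L, hL, hL'.symm⟩
  obtain ⟨L', ⟨L, hL, hLL'⟩, hmax⟩ :=
    set_has_maximal_iff_noetherian.2 (isNoetherian_of_isNoetherianRing_of_finite R N) S' hS'ne
  refine ⟨L, hL, fun L₁ hL₁ hle => ?_⟩
  obtain ⟨L₁', hL₁'⟩ := hlift L₁ hL₁
  have h1 : L' ≤ L₁' := fun x hx => by
    have hx' : x ∈ L.comap N.subtype := by
      rw [show L.comap N.subtype = L'.restrictScalars K from hLL']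
      exact hx
    have : x ∈ L₁'.restrictScalars K := hL₁' ▸ hle hx'
    exact this
  have h2 : L' = L₁' := by
    by_contra hne'
    exact hmax L₁' ⟨L₁, hL₁, hL₁'.symm⟩ (lt_of_le_of_ne h1 hne')
  intro x hx
  have hx' : (⟨x, (h𝒮 L₁ hL₁).2.1 hx⟩ : N) ∈ L₁'.restrictScalars K := hL₁' ▸ hx
  rw [← h2, ← hLL'] at hx'
  exact hx'

/-- A finite dimensional subspace can be enlarged so as to be stable under finitely many operators
that commute up to scalars and have square zero. -/
theorem exists_finiteDimensional_stable (T : κ → M →ₗ[K] M) {N : Submodule K M}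
    (hst : ∀ i, N ≤ N.comap (T i))
    (hcomm : ∀ i j, ∃ ε : ℤ, ∀ x ∈ N, T i (T j x) = ε • T j (T i x))
    (s : Finset κ) (hsq : ∀ i ∈ s, ∀ x ∈ N, T i (T i x) = 0)
    {V₀ : Submodule K M} [FiniteDimensional K V₀] (hV₀ : V₀ ≤ N) :
    ∃ V : Submodule K M, FiniteDimensional K V ∧ V₀ ≤ V ∧ V ≤ N ∧
      (∀ i ∈ s, V ≤ V.comap (T i)) ∧ ∀ i, V₀ ≤ V₀.comap (T i) → V ≤ V.comap (T i) := by
  classical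
  induction s using Finset.induction_on with
  | empty => exact ⟨V₀, inferInstance, le_rfl, hV₀, by simp, fun _ h => h⟩
  | insert a s ha ih =>
    obtain ⟨V, hVfd, hV₀V, hVN, hVs, hV⟩ := ih fun i hi => hsq i (Finset.mem_insert_of_mem hi)
    -- Commuting up to a scalar carries stability from `V` over to `T a V`, so enlarging `V` loses
    -- no stability already present. Stability under `T a` itself comes from its square being zero.
    have key (i) (hi : V ≤ V.comap (T i)) :
        V ⊔ V.map (T a) ≤ (V ⊔ V.map (T a)).comap (T i) := by
      refine sup_le (hi.trans (Submodule.comap_mono le_sup_left)) ?_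
      rintro _ ⟨x, hx, rfl⟩
      obtain ⟨ε, hε⟩ := hcomm i a
      refine Submodule.mem_sup_right ?_
      rw [hε x (hVN hx)]
      exact zsmul_mem (show T a (T i x) ∈ V.map (T a) from Submodule.mem_map_of_mem (hi hx)) ε
    refine ⟨V ⊔ V.map (T a), inferInstance, hV₀V.trans le_sup_left,
      sup_le hVN (Submodule.map_le_iff_le_comap.2 (hVN.trans (hst a))), ?_,
      fun i hi => key i (hV i hi)⟩
    intro i hi
    rcases Finset.mem_insert.1 hi with rfl | hi
    · refine sup_le (fun x hx => ?_) ?_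
      · exact Submodule.mem_sup_right (T := V.map (T i)) (Submodule.mem_map_of_mem hx)
      rintro _ ⟨x, hx, rfl⟩
      change T i (T i x) ∈ V ⊔ V.map (T i)
      rw [hsq i (Finset.mem_insert_self _ _) x (hVN hx)]
      exact zero_mem _
    · exact key i (hVs i hi)

/-- If `V` is stable under the operators outside `s`, and all operators commute up to scalars, then
the subspace generated by `V` under the operators in `s` is stable under all operators. -/
theorem le_of_stable_of_generates (T : κ → M →ₗ[K] M) {N V : Submodule K M}
    (hst : ∀ i, N ≤ N.comap (T i))
    (hcomm : ∀ i j, ∃ ε : ℤ, ∀ x ∈ N, T i (T j x) = ε • T j (T i x))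
    (s : Set κ) (hVN : V ≤ N) (hV : ∀ i ∉ s, V ≤ V.comap (T i))
    (hgen : ∀ L : Submodule K M, V ≤ L → (∀ i, L ≤ L.comap (T i)) → N ≤ L)
    {L : Submodule K M} (hVL : V ≤ L) (hL : ∀ i ∈ s, L ≤ L.comap (T i)) : N ≤ L := by
  let C : Submodule K M := sInf {L | V ≤ L ∧ ∀ i ∈ s, L ≤ L.comap (T i)}
  have hVC : V ≤ C := le_sInf fun L hL => hL.1
  have hCL {L : Submodule K M} (h : V ≤ L) (h' : ∀ i ∈ s, L ≤ L.comap (T i)) : C ≤ L :=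
    sInf_le ⟨h, h'⟩
  have hCN : C ≤ N := hCL hVN fun i _ => hst i
  have hCs : ∀ i ∈ s, C ≤ C.comap (T i) := fun i hi x hx => by
    refine Submodule.mem_sInf.2 fun L hL => ?_
    exact hL.2 i hi (Submodule.mem_sInf.1 hx L hL)
  refine (hgen C hVC fun i => ?_).trans (hCL hVL hL)
  by_cases hi : i ∈ s
  · exact hCs i hi
  -- The elements of `C` that `T i` sends into `C` contain `V` and are stable under the operators in
  -- `s`; by minimality they are all of `C`.
  · refine (hCL (L := C ⊓ C.comap (T i)) (le_inf hVC ((hV i hi).trans (Submodule.comap_mono hVC)))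
      fun j hj x hx => ⟨hCs j hj hx.1, ?_⟩).trans inf_le_right
    obtain ⟨ε, hε⟩ := hcomm i j
    change T i (T j x) ∈ C
    rw [hε x (hCN hx.1)]
    exact zsmul_mem (show T j (T i x) ∈ C from hCs j hj hx.2) ε

end StableSubspaces

/-! ### Multiplication operators and words in the generators. -/

section Words

variable {K A : Type*} [Field K] [NonUnitalNonAssocRing A] [Module K A]

namespace IsBicommutativeSuperalgebra

variable {P : ZMod 2 → Submodule K A} (hA : IsBicommutativeSuperalgebra P)
include hA

/-- Up to sign, `x(ab)·y = a(xb)·y = (ay)(xb) = x((ay)b) = x((ab)y)`, and the signs cancel. The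
middle factor has to be a product. -/
theorem mul_mul_comm_of_mem {i j k l : ZMod 2} {a b x y : A} (ha : a ∈ P i) (hb : b ∈ P j)
    (hx : x ∈ P k) (hy : y ∈ P l) : x * (a * b) * y = x * (a * b * y) := by
  have hs : ∀ i j k l : ZMod 2, (-1 : ℤ) ^ (k.val * i.val) *
      (-1) ^ ((k + j).val * l.val) * (-1) ^ ((i + l).val * k.val)
      = (-1) ^ (j.val * l.val) := by decide
  rw [hA.super_left_comm hx ha b, smul_mul_assoc, hA.super_right_comm (hA.mul_mem hx hb) hy a,
    hA.super_left_comm (hA.mul_mem ha hy) hx b, hA.super_right_comm hb hy a, mul_smul_comm,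
    smul_smul, smul_smul, hs]

/-- Exchanging an odd element with itself costs a sign, so the product is its own negative. The
characteristic enters only here and in the mirror statement for right multiplication. -/
theorem mul_mul_self_eq_zero (hK : (2 : K) ≠ 0) {x : A} (hx : x ∈ P 1) (y : A) :
    x * (x * y) = 0 := by
  have h := hA.super_left_comm hx hx y
  rw [show (-1 : ℤ) ^ ((1 : ZMod 2).val * (1 : ZMod 2).val) = -1 from rfl, neg_one_zsmul] at h
  have h2 : (2 : K) • (x * (x * y)) = 0 := by
    rw [two_smul]
    exact add_eq_zero_iff_eq_neg.2 h
  exact (smul_eq_zero.1 h2).resolve_left hK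

theorem mul_self_mul_eq_zero (hK : (2 : K) ≠ 0) {x : A} (hx : x ∈ P 1) (y : A) :
    y * x * x = 0 := by
  have h := hA.super_right_comm hx hx y
  rw [show (-1 : ℤ) ^ ((1 : ZMod 2).val * (1 : ZMod 2).val) = -1 from rfl, neg_one_zsmul] at h
  have h2 : (2 : K) • (y * x * x) = 0 := by
    rw [two_smul]
    exact add_eq_zero_iff_eq_neg.2 h
  exact (smul_eq_zero.1 h2).resolve_left hK

end IsBicommutativeSuperalgebra

/-- The elements obtained from products `g i * g j` by repeated left and right multiplication by
the `g k`; the two indices count the occurrences of each `g k` as a left and as a right factor. -/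
inductive GeneratorWord {κ : Type*} (g : κ → A) : (κ →₀ ℕ) → (κ →₀ ℕ) → A → Prop
  | mul (i j : κ) : GeneratorWord g (Finsupp.single i 1) (Finsupp.single j 1) (g i * g j)
  | left (k : κ) {l m : κ →₀ ℕ} {x : A} :
      GeneratorWord g l m x → GeneratorWord g (l + Finsupp.single k 1) m (g k * x)
  | right (k : κ) {l m : κ →₀ ℕ} {x : A} :
      GeneratorWord g l m x → GeneratorWord g l (m + Finsupp.single k 1) (x * g k)

variable {κ : Type*} {g : κ → A}

variable (K g) in
/-- The span of the words in the elements `g k`; it is the square of the subalgebra they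
generate. -/
def wordSpan : Submodule K A := Submodule.span K {x | ∃ l m, GeneratorWord g l m x}

theorem GeneratorWord.mem_wordSpan {l m : κ →₀ ℕ} {x : A} (h : GeneratorWord g l m x) :
    x ∈ wordSpan K g :=
  Submodule.subset_span ⟨l, m, h⟩

/-- Multiplications by the elements `g k`, from the left and from the right. -/
def multiplicationOps [IsScalarTower K A A] [SMulCommClass K A A] (g : κ → A) :
    κ ⊕ κ → A →ₗ[K] A :=
  Sum.elim (fun k => LinearMap.mulLeft K (g k)) fun k => LinearMap.mulRight K (g k)

section

variable [IsScalarTower K A A] [SMulCommClass K A A]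

theorem GeneratorWord.mem_of_stable {L : Submodule K A} (hmul : ∀ i j, g i * g j ∈ L)
    (hL : ∀ i, L ≤ L.comap (multiplicationOps g i)) {l m : κ →₀ ℕ} {x : A}
    (h : GeneratorWord g l m x) : x ∈ L := by
  induction h with
  | mul i j => exact hmul i j
  | left k _ ih => exact hL (Sum.inl k) ih
  | right k _ ih => exact hL (Sum.inr k) ih

theorem wordSpan_le_comap (i : κ ⊕ κ) :
    wordSpan K g ≤ (wordSpan K g).comap (multiplicationOps g i) := by
  refine Submodule.span_le.2 ?_
  rintro x ⟨l, m, hx⟩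
  rcases i with k | k
  · exact (hx.left k).mem_wordSpan
  · exact (hx.right k).mem_wordSpan

end

variable {P : ZMod 2 → Submodule K A} {par : κ → ZMod 2}

theorem GeneratorWord.exists_eq_mul (hA : IsBicommutativeSuperalgebra P)
    (hpar : ∀ k, g k ∈ P (par k)) {l m : κ →₀ ℕ} {x : A} (h : GeneratorWord g l m x) :
    ∃ i j, ∃ u ∈ P i, ∃ v ∈ P j, x = u * v := by
  induction h with
  | mul i j => exact ⟨_, _, _, hpar i, _, hpar j, rfl⟩
  | left k _ ih =>
    obtain ⟨i, j, u, hu, v, hv, rfl⟩ := ih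
    exact ⟨_, _, _, hpar k, _, hA.mul_mem hu hv, rfl⟩
  | right k _ ih =>
    obtain ⟨i, j, u, hu, v, hv, rfl⟩ := ih
    exact ⟨_, _, _, hA.mul_mem hu hv, _, hpar k, rfl⟩

theorem GeneratorWord.exists_parity (hA : IsBicommutativeSuperalgebra P)
    (hpar : ∀ k, g k ∈ P (par k)) {l m : κ →₀ ℕ} {x : A} (h : GeneratorWord g l m x) :
    ∃ i, x ∈ P i := by
  obtain ⟨i, j, u, hu, v, hv, rfl⟩ := h.exists_eq_mul hA hpar
  exact ⟨_, hA.mul_mem hu hv⟩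

theorem GeneratorWord.mul_mul_comm (hA : IsBicommutativeSuperalgebra P)
    (hpar : ∀ k, g k ∈ P (par k)) {l m : κ →₀ ℕ} {x : A} (h : GeneratorWord g l m x)
    (i j : κ) : g i * x * g j = g i * (x * g j) := by
  obtain ⟨_, _, u, hu, v, hv, rfl⟩ := h.exists_eq_mul hA hpar
  exact hA.mul_mul_comm_of_mem hu hv (hpar i) (hpar j)

section Vanishing

variable (hK : (2 : K) ≠ 0) (hA : IsBicommutativeSuperalgebra P) (hpar : ∀ k, g k ∈ P (par k))
include hK hA hpar

/-- The new factor moves inward, up to sign past left factors and freely past right ones, until it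
meets its earlier occurrence as a left factor; there the square is zero. -/
theorem GeneratorWord.mul_eq_zero_of_left {k : κ} (hk : par k = 1) {l m : κ →₀ ℕ} {x : A}
    (h : GeneratorWord g l m x) (hl : l k ≠ 0) : g k * x = 0 := by
  have hk' : g k ∈ P 1 := hk ▸ hpar k
  induction h with
  | mul i j =>
    obtain rfl : i = k := by
      by_contra hne
      exact hl (Finsupp.single_eq_of_ne' hne)
    exact hA.mul_mul_self_eq_zero hK hk' _
  | @left n l m x _ ih =>
    by_cases hnk : n = k
    · subst hnk
      exact hA.mul_mul_self_eq_zero hK hk' _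
    · rw [hA.super_left_comm (hpar k) (hpar n), ih, mul_zero, smul_zero]
      simpa [Finsupp.single_eq_of_ne' hnk] using hl
  | right n h ih =>
    rw [← h.mul_mul_comm hA hpar, ih hl, zero_mul]

theorem GeneratorWord.mul_eq_zero_of_right {k : κ} (hk : par k = 1) {l m : κ →₀ ℕ} {x : A}
    (h : GeneratorWord g l m x) (hm : m k ≠ 0) : x * g k = 0 := by
  have hk' : g k ∈ P 1 := hk ▸ hpar k
  induction h with
  | mul i j =>
    obtain rfl : j = k := by
      by_contra hne
      exact hm (Finsupp.single_eq_of_ne' hne)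
    exact hA.mul_self_mul_eq_zero hK hk' _
  | @right n l m x _ ih =>
    by_cases hnk : n = k
    · subst hnk
      exact hA.mul_self_mul_eq_zero hK hk' _
    · rw [hA.super_right_comm (hpar n) (hpar k), ih, zero_mul, smul_zero]
      simpa [Finsupp.single_eq_of_ne' hnk] using hm
  | left n h ih =>
    rw [h.mul_mul_comm hA hpar, ih hm, mul_zero]

/-- In a nonzero word an odd generator occurs at most once on each side. -/
theorem GeneratorWord.le_one_of_ne_zero {k : κ} (hk : par k = 1) {l m : κ →₀ ℕ} {x : A}
    (h : GeneratorWord g l m x) (hx : x ≠ 0) : l k ≤ 1 ∧ m k ≤ 1 := by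
  classical
  induction h with
  | mul i j => simp only [Finsupp.single_apply]; split_ifs <;> simp
  | @left n l m x h ih =>
    obtain ⟨h1, h2⟩ := ih (right_ne_zero_of_mul hx)
    refine ⟨?_, h2⟩
    rw [Finsupp.add_apply, Finsupp.single_apply]
    split_ifs with hn
    · subst hn
      have : l n = 0 := by
        by_contra hl
        exact hx (h.mul_eq_zero_of_left hK hA hpar hk hl)
      omega
    · exact h1
  | @right n l m x h ih =>
    obtain ⟨h1, h2⟩ := ih (left_ne_zero_of_mul hx)
    refine ⟨h1, ?_⟩
    rw [Finsupp.add_apply, Finsupp.single_apply]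
    split_ifs with hn
    · subst hn
      have : m n = 0 := by
        by_contra hm
        exact hx (h.mul_eq_zero_of_right hK hA hpar hk hm)
      omega
    · exact h2

end Vanishing

/-- Zero generators must be allowed, since they arise as even or odd parts of the given generators.
-/
theorem GeneratorWord.eq_zero_of_ne_zero {k : κ} (hk : g k = 0) {l m : κ →₀ ℕ} {x : A}
    (h : GeneratorWord g l m x) (hx : x ≠ 0) : l k = 0 ∧ m k = 0 := by
  classical
  induction h with
  | mul i j =>
    constructor <;> refine Finsupp.single_eq_of_ne' ?_ <;> rintro rfl <;> exact hx (by simp [hk])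
  | left n h ih =>
    obtain ⟨h1, h2⟩ := ih (right_ne_zero_of_mul hx)
    have : n ≠ k := by rintro rfl; exact hx (by simp [hk])
    simp [h1, h2, Finsupp.single_eq_of_ne' this]
  | right n h ih =>
    obtain ⟨h1, h2⟩ := ih (left_ne_zero_of_mul hx)
    have : n ≠ k := by rintro rfl; exact hx (by simp [hk])
    simp [h1, h2, Finsupp.single_eq_of_ne' this]

/-- The sign in the commutation of two multiplication operators. -/
def multiplicationSign (par : κ → ZMod 2) : κ ⊕ κ → κ ⊕ κ → ℤ
  | .inl i, .inl j => (-1) ^ ((par i).val * (par j).val)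
  | .inr i, .inr j => (-1) ^ ((par i).val * (par j).val)
  | _, _ => 1

theorem multiplicationSign_eq_one {i : κ ⊕ κ} (hi : Sum.elim par par i = 0) (j : κ ⊕ κ) :
    multiplicationSign par i j = 1 := by
  rcases i with i | i <;> rcases j with j | j <;> simp_all [multiplicationSign]

section Operators

variable [IsScalarTower K A A] [SMulCommClass K A A]
  (hA : IsBicommutativeSuperalgebra P) (hpar : ∀ k, g k ∈ P (par k))
include hA hpar

theorem multiplicationOps_comm (i j : κ ⊕ κ) {x : A} (hx : x ∈ wordSpan K g) :
    multiplicationOps (K := K) g i (multiplicationOps (K := K) g j x)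
      = multiplicationSign par i j • multiplicationOps (K := K) g j (multiplicationOps (K := K) g i x) := by
  have hLR (i j : κ) : g i * x * g j = g i * (x * g j) := by
    have : wordSpan K g ≤ LinearMap.eqLocus
        (LinearMap.mulRight K (g j) ∘ₗ LinearMap.mulLeft K (g i))
        (LinearMap.mulLeft K (g i) ∘ₗ LinearMap.mulRight K (g j)) := by
      refine Submodule.span_le.2 ?_
      rintro y ⟨l, m, hy⟩
      exact hy.mul_mul_comm hA hpar i j
    exact this hx
  rcases i with i | i <;> rcases j with j | j
  · exact hA.super_left_comm (hpar i) (hpar j) x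
  · exact (hLR i j).symm.trans (one_smul ℤ _).symm
  · exact (hLR j i).trans (one_smul ℤ _).symm
  · exact hA.super_right_comm (hpar j) (hpar i) x |>.trans (by rw [mul_comm]; rfl)

theorem multiplicationOps_sq (hK : (2 : K) ≠ 0) {i : κ ⊕ κ}
    (hi : Sum.elim par par i = 1) (x : A) :
    multiplicationOps (K := K) g i (multiplicationOps (K := K) g i x) = 0 := by
  rcases i with k | k
  · exact hA.mul_mul_self_eq_zero hK (show g k ∈ P 1 from hi ▸ hpar k) x
  · exact hA.mul_self_mul_eq_zero hK (show g k ∈ P 1 from hi ▸ hpar k) x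

/-- The outermost factor of `y` is either pulled out of the product or transferred to `x`. A
transfer can interchange the two words, so both orders are proved together, for all `x`. -/
theorem GeneratorWord.mul_mem_wordSpan {l m l' m' : κ →₀ ℕ} {x y : A}
    (hx : GeneratorWord g l m x) (hy : GeneratorWord g l' m' y) :
    x * y ∈ wordSpan K g ∧ y * x ∈ wordSpan K g := by
  have hleft (k : κ) {z : A} (hz : z ∈ wordSpan K g) : g k * z ∈ wordSpan K g :=
    wordSpan_le_comap (Sum.inl k) hz
  have hright (k : κ) {z : A} (hz : z ∈ wordSpan K g) : z * g k ∈ wordSpan K g :=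
    wordSpan_le_comap (Sum.inr k) hz
  induction hy generalizing l m x with
  | mul i j =>
    obtain ⟨p, hp⟩ := hx.exists_parity hA hpar
    constructor
    · rw [hA.super_left_comm hp (hpar i)]
      exact zsmul_mem (hleft i (hx.right j).mem_wordSpan) _
    · rw [hA.super_right_comm (hpar j) hp]
      exact zsmul_mem (hright j (hx.left i).mem_wordSpan) _
  | left k hy ih =>
    obtain ⟨p, hp⟩ := hx.exists_parity hA hpar
    obtain ⟨p', hp'⟩ := hy.exists_parity hA hpar
    constructor
    · rw [hA.super_left_comm hp (hpar k)]
      exact zsmul_mem (hleft k (ih hx).1) _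
    · rw [hA.super_right_comm hp' hp]
      exact zsmul_mem (ih (hx.left k)).1 _
  | right k hy ih =>
    obtain ⟨p, hp⟩ := hx.exists_parity hA hpar
    obtain ⟨p', hp'⟩ := hy.exists_parity hA hpar
    constructor
    · rw [hA.super_left_comm hp hp']
      exact zsmul_mem (ih (hx.right k)).2 _
    · rw [hA.super_right_comm (hpar k) hp]
      exact zsmul_mem (hright k (ih hx).2) _

/-- A bicommutative superalgebra is spanned by its generators and the words in them. -/
theorem span_generators_union_words_eq_top (htop : NonUnitalAlgebra.adjoin K (Set.range g) = ⊤) :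
    Submodule.span K (Set.range g ∪ {x | ∃ l m, GeneratorWord g l m x}) = ⊤ := by
  set S : Set A := Set.range g ∪ {x | ∃ l m, GeneratorWord g l m x}
  have hwS : wordSpan K g ≤ Submodule.span K S := Submodule.span_mono Set.subset_union_right
  have hmul (x) (hx : x ∈ S) (y) (hy : y ∈ S) : x * y ∈ wordSpan K g := by
    rcases hx with ⟨i, rfl⟩ | ⟨l, m, hx⟩ <;> rcases hy with ⟨j, rfl⟩ | ⟨l', m', hy⟩
    · exact (GeneratorWord.mul i j).mem_wordSpan
    · exact (hy.left i).mem_wordSpan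
    · exact (hx.right j).mem_wordSpan
    · exact (hx.mul_mem_wordSpan hA hpar hy).1
  rw [eq_top_iff]
  intro x _
  have hx : x ∈ NonUnitalAlgebra.adjoin K (Set.range g) := htop ▸ NonUnitalAlgebra.mem_top
  induction hx using NonUnitalAlgebra.adjoin_induction with
  | mem x hx => exact Submodule.subset_span (Or.inl hx)
  | add x y _ _ hx hy => exact add_mem (hx trivial) (hy trivial)
  | zero => exact zero_mem _
  | smul r x _ hx => exact Submodule.smul_mem _ r (hx trivial)
  | mul x y _ _ hx hy =>
    refine hwS ?_
    replace hx := hx trivial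
    replace hy := hy trivial
    have h1 : ∀ s ∈ S, Submodule.span K S ≤ (wordSpan K g).comap (LinearMap.mulLeft K s) :=
      fun s hs => Submodule.span_le.2 fun t ht => hmul s hs t ht
    have h2 : Submodule.span K S ≤ (wordSpan K g).comap (LinearMap.mulRight K y) :=
      Submodule.span_le.2 fun s hs => h1 s hs hy
    exact h2 hx

end Operators

end Words

/-! ### Degrees of words: finite dimensionality, weight bound, rationality. -/

section GradedGenerators

open DirectSum

variable {K A : Type*} [Field K] [NonUnitalNonAssocRing A] [Module K A]
  {κ : Type*} {g : κ → A}
  {σ : Type*} [DecidableEq σ] {𝒜 : (σ →₀ ℕ) → Submodule K A} {deg : κ → σ →₀ ℕ}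

theorem GeneratorWord.mem_graded (h𝒜 : IsAlgGrading 𝒜) (hdeg : ∀ k, g k ∈ 𝒜 (deg k))
    {l m : κ →₀ ℕ} {x : A} (h : GeneratorWord g l m x) : x ∈ 𝒜 (Finsupp.weight deg (l + m)) := by
  induction h with
  | mul i j =>
    rw [map_add, Finsupp.weight_single, Finsupp.weight_single, one_smul, one_smul]
    exact h𝒜.mul_mem (hdeg i) (hdeg j)
  | @left k l m x h ih =>
    rw [add_right_comm, add_comm, map_add, Finsupp.weight_single, one_smul]
    exact h𝒜.mul_mem (hdeg k) ih
  | @right k l m x h ih =>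
    rw [← add_assoc, map_add, Finsupp.weight_single, one_smul]
    exact h𝒜.mul_mem ih (hdeg k)

theorem finite_setOf_generatorWord_degree_lt [Finite κ] (g : κ → A) (n : ℕ) :
    {x | ∃ l m, GeneratorWord g l m x ∧ (l + m).degree < n}.Finite := by
  induction n with
  | zero => simp
  | succ n ih =>
    have hfin := ((Set.finite_range fun p : κ × κ => g p.1 * g p.2).union
      ((Set.finite_iUnion fun k => ih.image (g k * ·)).union
        (Set.finite_iUnion fun k => ih.image (· * g k))))
    refine hfin.subset ?_
    rintro _ ⟨l, m, h, hn⟩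
    cases h with
    | mul i j => exact Or.inl ⟨(i, j), rfl⟩
    | @left k l m x h =>
      refine Or.inr (Or.inl (Set.mem_iUnion.2 ⟨k, x, ⟨l, m, h, ?_⟩, rfl⟩))
      simp only [map_add, Finsupp.degree_single] at hn ⊢
      omega
    | @right k l m x h =>
      refine Or.inr (Or.inr (Set.mem_iUnion.2 ⟨k, x, ⟨l, m, h, ?_⟩, rfl⟩))
      simp only [map_add, Finsupp.degree_single] at hn ⊢
      omega

/-- Generators of degree zero vanish, so each letter of a nonzero word contributes at least 1 to the
total degree. Thus the degree bounds the length, and there are finitely many words of bounded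
length. -/
theorem GeneratorWord.degree_le_of_zero_component_eq_bot [Finite κ]
    (hdeg : ∀ k, g k ∈ 𝒜 (deg k)) (h0 : 𝒜 0 = ⊥)
    {l m : κ →₀ ℕ} {x : A} (h : GeneratorWord g l m x) (hx : x ≠ 0) :
    (l + m).degree ≤ (Finsupp.weight deg (l + m)).degree := by
  have := Fintype.ofFinite κ
  rw [Finsupp.weight_eq_sum, map_sum, Finsupp.degree_eq_sum]
  refine Finset.sum_le_sum fun k _ => ?_
  rw [map_nsmul, smul_eq_mul]
  by_cases hk : deg k = 0
  · have hgk : g k = 0 := by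
      have := hdeg k
      rwa [hk, h0, Submodule.mem_bot] at this
    obtain ⟨h1, h2⟩ := h.eq_zero_of_ne_zero hgk hx
    simp [h1, h2]
  · exact Nat.le_mul_of_pos_right _ (Nat.pos_of_ne_zero ((Finsupp.degree_eq_zero_iff _).not.2 hk))

theorem exists_mem_graded_of_mem_generators_union_words (h𝒜 : IsAlgGrading 𝒜)
    (hdeg : ∀ k, g k ∈ 𝒜 (deg k)) :
    ∀ x ∈ Set.range g ∪ {x | ∃ l m, GeneratorWord g l m x}, ∃ d, x ∈ 𝒜 d := by
  rintro _ (⟨k, rfl⟩ | ⟨l, m, h⟩)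
  · exact ⟨_, hdeg k⟩
  · exact ⟨_, h.mem_graded h𝒜 hdeg⟩

theorem multiplicationOps_mem_graded [IsScalarTower K A A] [SMulCommClass K A A]
    (h𝒜 : IsAlgGrading 𝒜) (hdeg : ∀ k, g k ∈ 𝒜 (deg k)) (i : κ ⊕ κ) (d : σ →₀ ℕ) :
    𝒜 d ≤ (𝒜 (d + Sum.elim deg deg i)).comap (multiplicationOps g i) := by
  rcases i with k | k
  · intro x hx
    change g k * x ∈ 𝒜 (d + deg k)
    rw [add_comm]
    exact h𝒜.mul_mem (hdeg k) hx
  · exact fun x hx => h𝒜.mul_mem hx (hdeg k)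

section

variable [IsScalarTower K A A] [SMulCommClass K A A]
  {P : ZMod 2 → Submodule K A} {par : κ → ZMod 2}
  (h𝒜 : IsAlgGrading 𝒜) (hdeg : ∀ k, g k ∈ 𝒜 (deg k))
  (hA : IsBicommutativeSuperalgebra P) (hpar : ∀ k, g k ∈ P (par k))
include h𝒜 hdeg hA hpar

/-- The words are finitely generated under the multiplications by even generators of nonzero
degree, if the components are finite dimensional. -/
theorem exists_finiteDimensional_generating_wordSpan [Fintype κ] (hK : (2 : K) ≠ 0)
    [∀ d, FiniteDimensional K (𝒜 d)] (E : Set (κ ⊕ κ))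
    (hE : ∀ i ∉ E, Sum.elim par par i = 1 ∨ Sum.elim deg deg i = 0 ∨ Sum.elim g g i = 0) :
    ∃ V : Submodule K A, FiniteDimensional K V ∧ V ≤ wordSpan K g ∧
      ∀ L : Submodule K A, V ≤ L → (∀ i ∈ E, L ≤ L.comap (multiplicationOps g i)) →
        wordSpan K g ≤ L := by
  classical
  -- `W` contains all products of two generators, is finite dimensional, and is stable under
  -- operators of degree zero. Closing `wordSpan K g ⊓ W` under the odd operators gives the
  -- generating space.
  let W : Submodule K A := ⨆ p : κ × κ, 𝒜 (deg p.1 + deg p.2)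
  have hW : FiniteDimensional K W := Submodule.finiteDimensional_iSup _
  have hcomm (i j : κ ⊕ κ) : ∃ ε : ℤ, ∀ x ∈ wordSpan K g,
      multiplicationOps (K := K) g i (multiplicationOps (K := K) g j x)
        = ε • multiplicationOps (K := K) g j (multiplicationOps (K := K) g i x) :=
    ⟨_, fun _ hx => multiplicationOps_comm hA hpar i j hx⟩
  have hfin : FiniteDimensional K (wordSpan K g ⊓ W : Submodule K A) :=
    Submodule.finiteDimensional_of_le inf_le_right
  obtain ⟨V, hV, hWV, hVN, hVodd, hVst⟩ := exists_finiteDimensional_stable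
    (multiplicationOps (K := K) g) wordSpan_le_comap hcomm
    (Finset.univ.filter fun i => Sum.elim par par i = 1)
    (fun i hi x _ => multiplicationOps_sq hA hpar hK (Finset.mem_filter.1 hi).2 x)
    (V₀ := wordSpan K g ⊓ W) inf_le_left
  refine ⟨V, hV, hVN, fun L hVL hL => ?_⟩
  refine le_of_stable_of_generates (multiplicationOps (K := K) g) wordSpan_le_comap hcomm E hVN
    (fun i hi => ?_) (fun L' hVL' hL' => ?_) hVL hL
  · rcases hE i hi with hi | hi | hi
    · exact hVodd i (Finset.mem_filter.2 ⟨Finset.mem_univ _, hi⟩)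
    · refine hVst i fun x hx => ⟨wordSpan_le_comap i hx.1, ?_⟩
      have hWi : W ≤ W.comap (multiplicationOps g i) := iSup_le fun p y hy => by
        refine Submodule.mem_iSup_of_mem p ?_
        have := multiplicationOps_mem_graded h𝒜 hdeg i _ hy
        rwa [hi, add_zero] at this
      exact hWi hx.2
    · intro x _
      have : multiplicationOps (K := K) g i x = 0 := by
        rcases i with k | k
        · change g k * x = 0
          rw [show g k = 0 from hi, zero_mul]
        · change x * g k = 0
          rw [show g k = 0 from hi, mul_zero]
      rw [Submodule.mem_comap, this]
      exact zero_mem _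
  · refine Submodule.span_le.2 ?_
    rintro x ⟨l, m, hx⟩
    refine hx.mem_of_stable (fun i j => hVL' (hWV ⟨(GeneratorWord.mul i j).mem_wordSpan, ?_⟩)) hL'
    exact Submodule.mem_iSup_of_mem (i, j) (h𝒜.mul_mem (hdeg i) (hdeg j))

variable (htop : NonUnitalAlgebra.adjoin K (Set.range g) = ⊤)
include htop

theorem finiteDimensional_component_of_zero_component_eq_bot [Finite κ] (h0 : 𝒜 0 = ⊥)
    (e : σ →₀ ℕ) : FiniteDimensional K (𝒜 e) := by
  let _ := h𝒜.isInternal.chooseDecomposition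
  let F : Set A := {0} ∪ Set.range g ∪
    {x | ∃ l m, GeneratorWord g l m x ∧ (l + m).degree < e.degree + 1}
  have hF : F.Finite := ((Set.finite_singleton 0).union (Set.finite_range g)).union
    (finite_setOf_generatorWord_degree_lt g _)
  have hle : 𝒜 e ≤ Submodule.span K F := by
    refine (le_span_inter_of_span_eq_top
      (exists_mem_graded_of_mem_generators_union_words h𝒜 hdeg)
      (span_generators_union_words_eq_top hA hpar htop) e).trans (Submodule.span_mono ?_)
    rintro x ⟨⟨k, rfl⟩ | ⟨l, m, h⟩, hxe⟩
    · exact Or.inl (Or.inr ⟨k, rfl⟩)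
    · by_cases hx : x = 0
      · exact Or.inl (Or.inl hx)
      · refine Or.inr ⟨l, m, h, Nat.lt_succ_of_le ?_⟩
        rw [degree_eq_of_mem_mem 𝒜 hxe (h.mem_graded h𝒜 hdeg) hx]
        exact h.degree_le_of_zero_component_eq_bot hdeg h0 hx
  have := FiniteDimensional.span_of_finite K hF
  exact Submodule.finiteDimensional_of_le hle

/-- An additive weight that vanishes on the degrees of the nonzero even generators is bounded on
the degrees that occur. -/
theorem weight_le_of_component_ne_bot [Fintype κ] (hK : (2 : K) ≠ 0) (w : (σ →₀ ℕ) →+ ℕ)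
    (hw : ∀ k, par k = 0 → w (deg k) = 0 ∨ g k = 0) {e : σ →₀ ℕ} (he : 𝒜 e ≠ ⊥) :
    w e ≤ 2 * ∑ k, if par k = 1 then w (deg k) else 0 := by
  let _ := h𝒜.isInternal.chooseDecomposition
  have hpar01 : ∀ i : ZMod 2, i = 0 ∨ i = 1 := by decide
  by_contra hlt
  refine he (eq_bot_iff.2 ?_)
  refine (le_span_inter_of_span_eq_top
      (exists_mem_graded_of_mem_generators_union_words h𝒜 hdeg)
      (span_generators_union_words_eq_top hA hpar htop) e).trans (Submodule.span_le.2 ?_)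
  rintro x ⟨hx, hxe⟩
  change x = 0
  by_contra hx0
  refine hlt ?_
  rcases hx with ⟨k, rfl⟩ | ⟨l, m, h⟩
  · rw [degree_eq_of_mem_mem 𝒜 hxe (hdeg k) hx0]
    rcases hpar01 (par k) with hk | hk
    · simp [(hw k hk).resolve_right hx0]
    · have := Finset.single_le_sum (f := fun k => if par k = 1 then w (deg k) else 0)
        (fun _ _ => Nat.zero_le _) (Finset.mem_univ k)
      simp only [hk, if_true] at this
      omega
  · rw [degree_eq_of_mem_mem 𝒜 hxe (h.mem_graded h𝒜 hdeg) hx0, Finsupp.weight_eq_sum, map_sum,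
      Finset.mul_sum]
    refine Finset.sum_le_sum fun k _ => ?_
    rw [map_nsmul, smul_eq_mul, Finsupp.add_apply]
    rcases hpar01 (par k) with hk | hk
    · rcases hw k hk with hk' | hk'
      · simp [hk']
      · obtain ⟨h1, h2⟩ := h.eq_zero_of_ne_zero hk' hx0
        simp [h1, h2]
    -- Source of the factor 2: one occurrence on the left and one on the right.
    · obtain ⟨h1, h2⟩ := h.le_one_of_ne_zero hK hA hpar hk hx0
      rw [if_pos hk]
      exact Nat.mul_le_mul_right _ (by omega)

/-- Rationality of the Hilbert series, with denominators coming from the even generators of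
nonzero degree. -/
theorem exists_isPolynomial_hilbertSeries_mul_prod [Fintype κ] (hK : (2 : K) ≠ 0)
    (hfin : ∀ d, FiniteDimensional K (𝒜 d)) (D : (σ →₀ ℕ) → Prop)
    (hD : ∀ k, par k = 0 → D (deg k) ∨ g k = 0) :
    ∃ (s : ℕ) (d : Fin s → σ →₀ ℕ), (∀ i, d i ≠ 0 ∧ D (d i)) ∧
      (subspaceHilbertSeries 𝒜 ⊤ *
        ∏ i, (1 - MvPowerSeries.monomial (d i) 1)).IsPolynomial := by
  classical
  let _ := h𝒜.isInternal.chooseDecomposition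
  have hpar01 : ∀ i : ZMod 2, i = 0 ∨ i = 1 := by decide
  let deg' : κ ⊕ κ → σ →₀ ℕ := Sum.elim deg deg
  let E : Finset (κ ⊕ κ) :=
    Finset.univ.filter fun i => Sum.elim par par i = 0 ∧ deg' i ≠ 0 ∧ D (deg' i)
  have hE_mem (i) : i ∈ E ↔ Sum.elim par par i = 0 ∧ deg' i ≠ 0 ∧ D (deg' i) := by simp [E]
  have hhom := exists_mem_graded_of_mem_generators_union_words h𝒜 hdeg
  have hNhom : IsHomogeneousSubspace 𝒜 (wordSpan K g) :=
    isHomogeneousSubspace_span fun x hx => hhom x (Or.inr hx)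
  -- Modulo words the algebra is spanned by the generators, so the two series differ only in the
  -- finitely many degrees `deg k`.
  have hlow : (subspaceHilbertSeries 𝒜 ⊤
      - subspaceHilbertSeries 𝒜 (wordSpan K g)).IsPolynomial := by
    refine isPolynomial_subspaceHilbertSeries_sub le_top
      ((Set.finite_range deg).subset fun d hd => ?_)
    by_contra hd'
    refine hd (inf_le_right.trans ((le_span_inter_of_span_eq_top hhom
      (span_generators_union_words_eq_top hA hpar htop) d).trans (Submodule.span_le.2 ?_)))
    rintro x ⟨⟨k, rfl⟩ | ⟨l, m, h⟩, hxd⟩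
    · have : g k = 0 := by
        by_contra hk
        exact hd' ⟨k, degree_eq_of_mem_mem 𝒜 (hdeg k) hxd hk⟩
      rw [this]
      exact zero_mem _
    · exact h.mem_wordSpan
  obtain ⟨V, hV, hVN, hgen⟩ := exists_finiteDimensional_generating_wordSpan h𝒜 hdeg hA hpar hK
    (E : Set (κ ⊕ κ)) (fun i hi => by
      rw [Finset.mem_coe, hE_mem] at hi
      rcases i with k | k <;>
      · rcases hpar01 (par k) with hk | hk
        · rcases hD k hk with hDk | hgk
          · exact Or.inr (Or.inl (by_contra fun h => hi ⟨hk, h, hDk⟩))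
          · exact Or.inr (Or.inr hgk)
        · exact Or.inl hk)
  have hcomm : ∀ i ∈ E, ∀ j ∈ E, ∀ x ∈ wordSpan K g,
      multiplicationOps (K := K) g i (multiplicationOps (K := K) g j x)
        = multiplicationOps (K := K) g j (multiplicationOps (K := K) g i x) := by
    intro i hi j _ x hx
    rw [multiplicationOps_comm hA hpar i j hx,
      multiplicationSign_eq_one ((hE_mem i).1 hi).1, one_smul]
  have hmain := isPolynomial_subspaceHilbertSeries_sub_mul_prod (𝒜 := 𝒜)
    (multiplicationOps (K := K) g) deg' E (fun i _ => multiplicationOps_mem_graded h𝒜 hdeg i)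
    ⊥ (wordSpan K g) bot_le
    (fun x hx d => by rw [(Submodule.mem_bot K).1 hx, map_zero]; exact zero_mem _)
    hNhom (fun _ _ => bot_le) (fun i _ => wordSpan_le_comap i) hcomm
    (maximalCondition_of_generates _ E.finite_toSet (fun i _ => wordSpan_le_comap i) hcomm hVN hgen)
  rw [subspaceHilbertSeries_bot, sub_zero] at hmain
  refine ⟨E.card, fun i => deg' (E.equivFin.symm i),
    fun i => ((hE_mem _).1 (E.equivFin.symm i).2).2, ?_⟩
  have hprod : ∏ i : Fin E.card, (1 - MvPowerSeries.monomial (deg' (E.equivFin.symm i)) (1 : ℤ))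
      = ∏ i ∈ E, (1 - MvPowerSeries.monomial (deg' i) (1 : ℤ)) := by
    rw [← Finset.prod_coe_sort E,
      ← Equiv.prod_comp E.equivFin.symm fun i : E => 1 - MvPowerSeries.monomial (deg' i) (1 : ℤ)]
  rw [hprod]
  have hpoly := hlow.mul (MvPowerSeries.IsPolynomial.prod E
    (fun i => 1 - MvPowerSeries.monomial (deg' i) (1 : ℤ)) fun i _ => .sub .one (.monomial _ _))
  convert hpoly.add hmain using 1
  ring

end

end GradedGenerators

/-! ### Splitting generators into even and odd parts. -/

section ParitySplitting

variable {K A : Type*} [Field K] [NonUnitalNonAssocRing A] [Module K A]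

theorem IsAlgGrading.eq_zero_of_mem_of_mem {ι : Type*} [DecidableEq ι] [Add ι]
    {𝒜 : ι → Submodule K A} (h : IsAlgGrading 𝒜) {i j : ι} (hij : i ≠ j) {x : A}
    (hi : x ∈ 𝒜 i) (hj : x ∈ 𝒜 j) : x = 0 := by
  let _ := h.isInternal.chooseDecomposition
  by_contra hx
  exact hij (DirectSum.degree_eq_of_mem_mem 𝒜 hi hj hx)

variable [IsScalarTower K A A] [SMulCommClass K A A] {P : ZMod 2 → Submodule K A}

/-- The results on graded bicommutative superalgebras for generators that are homogeneous in the
grading, but need not be homogeneous in the parity. The predicate `D` holds for the degrees that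
may occur in the denominator. -/
theorem IsBicommutativeSuperalgebra.hilbertSeries_of_generators (hK : (2 : K) ≠ 0)
    (hA : IsBicommutativeSuperalgebra P) {σ : Type*} [DecidableEq σ]
    {𝒜 : (σ →₀ ℕ) → Submodule K A} (h𝒜 : IsSuperalgebraGrading P 𝒜) {τ : Type*} [Fintype τ]
    (a : τ → A) (deg : τ → σ →₀ ℕ) (htop : NonUnitalAlgebra.adjoin K (Set.range a) = ⊤)
    (hdeg : ∀ i, a i ∈ 𝒜 (deg i)) (D : (σ →₀ ℕ) → Prop) (hD : ∀ i, ¬ D (deg i) → a i ∈ P 1) :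
    (𝒜 0 = ⊥ → ∀ e, FiniteDimensional K (𝒜 e)) ∧
    ((∀ e, FiniteDimensional K (𝒜 e)) →
      ∃ (s : ℕ) (d : Fin s → σ →₀ ℕ), (∀ i, d i ≠ 0 ∧ D (d i)) ∧
        (subspaceHilbertSeries 𝒜 ⊤ *
          ∏ i, (1 - MvPowerSeries.monomial (d i) 1)).IsPolynomial) ∧
    (∀ w : (σ →₀ ℕ) →+ ℕ, (∀ e, D e → w e = 0) → ∀ e, 𝒜 e ≠ ⊥ →
      w e ≤ 2 * ∑ i, w (deg i)) := by
  have hsplit (i : τ) : ∃ x ∈ 𝒜 (deg i) ⊓ P 0, ∃ y ∈ 𝒜 (deg i) ⊓ P 1, x + y = a i :=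
    Submodule.mem_sup.1 (h𝒜.parity (deg i) (hdeg i))
  choose x hx y hy hxy using hsplit
  let par : τ ⊕ τ → ZMod 2 := Sum.elim (fun _ => 0) fun _ => 1
  have hg_deg : ∀ k, Sum.elim x y k ∈ 𝒜 (Sum.elim deg deg k) := by
    rintro (k | k)
    exacts [(hx k).1, (hy k).1]
  have hg_par : ∀ k, Sum.elim x y k ∈ P (par k) := by
    rintro (k | k)
    exacts [(hx k).2, (hy k).2]
  have hg_top : NonUnitalAlgebra.adjoin K (Set.range (Sum.elim x y)) = ⊤ := by
    rw [eq_top_iff, ← htop]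
    refine NonUnitalAlgebra.adjoin_le ?_
    rintro _ ⟨i, rfl⟩
    rw [← hxy i]
    exact add_mem (NonUnitalAlgebra.subset_adjoin K ⟨Sum.inl i, rfl⟩)
      (NonUnitalAlgebra.subset_adjoin K ⟨Sum.inr i, rfl⟩)
  have hg_even : ∀ k, par k = 0 → D (Sum.elim deg deg k) ∨ Sum.elim x y k = 0 := by
    rintro (k | k) hk
    · by_cases hDk : D (deg k)
      · exact Or.inl hDk
      -- Here `a k` is odd, so its even part is also odd and hence zero.
      · refine Or.inr (hA.eq_zero_of_mem_of_mem zero_ne_one (hx k).2 ?_)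
        change x k ∈ P 1
        rw [eq_sub_of_add_eq (hxy k)]
        exact sub_mem (hD k hDk) (hy k).2
    · exact absurd hk one_ne_zero
  refine ⟨finiteDimensional_component_of_zero_component_eq_bot h𝒜.toIsAlgGrading hg_deg hA
      hg_par hg_top,
    fun hfin => exists_isPolynomial_hilbertSeries_mul_prod h𝒜.toIsAlgGrading hg_deg hA hg_par
      hg_top hK hfin D hg_even,
    fun w hw e he => ?_⟩
  -- Only the odd parts contribute to this bound, so splitting each generator in two does not double
  -- it.
  have := weight_le_of_component_ne_bot h𝒜.toIsAlgGrading hg_deg hA hg_par hg_top hK w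
    (fun k hk => (hg_even k hk).imp_left (hw _)) he
  simpa [par, Fintype.sum_sum_type] using this

end ParitySplitting

/-! ### Polynomial numerators and their degrees. -/

section PowerSeriesForms

theorem MvPowerSeries.IsPolynomial.exists_polynomial {H : PowerSeries ℤ}
    (h : MvPowerSeries.IsPolynomial H) : ∃ f : Polynomial ℤ, (f : PowerSeries ℤ) = H := by
  obtain ⟨f, rfl⟩ := h
  exact ⟨MvPolynomial.uniqueAlgEquiv ℤ Unit f, MvPolynomial.toMvPowerSeries_pUnitAlgEquiv.symm⟩

theorem MvPowerSeries.monomial_eq_prod_X_inl {α β : Type*} [Fintype α] [Fintype β]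
    {e : α ⊕ β →₀ ℕ} (he : ∀ j, e (Sum.inr j) = 0) :
    (MvPowerSeries.monomial e 1 : MvPowerSeries (α ⊕ β) ℤ)
      = ∏ k : α, MvPowerSeries.X (Sum.inl k) ^ e (Sum.inl k) := by
  rw [MvPowerSeries.monomial_one_eq, Finsupp.prod_fintype _ _ fun _ => pow_zero _,
    Fintype.prod_sum_type]
  simp [he]

section DegreeBound

variable {σ : Type*} {H Q : MvPowerSeries σ ℤ}

/-- The additive weight `w` is at most `B` on the exponents that occur in `H`. -/
def MvPowerSeries.WeightLE (w : (σ →₀ ℕ) →+ ℕ) (H : MvPowerSeries σ ℤ) (B : ℕ) : Prop :=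
  ∀ e, MvPowerSeries.coeff e H ≠ 0 → w e ≤ B

variable {w : (σ →₀ ℕ) →+ ℕ} {B B' : ℕ}

theorem MvPowerSeries.WeightLE.mul (hH : MvPowerSeries.WeightLE w H B)
    (hQ : MvPowerSeries.WeightLE w Q B') : MvPowerSeries.WeightLE w (H * Q) (B + B') := by
  classical
  intro e he
  rw [MvPowerSeries.coeff_mul] at he
  obtain ⟨p, hp, hne⟩ := Finset.exists_ne_zero_of_sum_ne_zero he
  rw [← Finset.HasAntidiagonal.mem_antidiagonal.1 hp, map_add]
  exact add_le_add (hH _ (left_ne_zero_of_mul hne)) (hQ _ (right_ne_zero_of_mul hne))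

theorem MvPowerSeries.WeightLE.monomial {e : σ →₀ ℕ} (he : w e ≤ B) (a : ℤ) :
    MvPowerSeries.WeightLE w (MvPowerSeries.monomial e a) B := by
  classical
  intro c hc
  rw [MvPowerSeries.coeff_monomial] at hc
  split_ifs at hc with h
  · exact h ▸ he
  · exact absurd rfl hc

theorem MvPowerSeries.WeightLE.one : MvPowerSeries.WeightLE w (1 : MvPowerSeries σ ℤ) B :=
  .monomial (by simp) 1

theorem MvPowerSeries.WeightLE.sub (hH : MvPowerSeries.WeightLE w H B)
    (hQ : MvPowerSeries.WeightLE w Q B) : MvPowerSeries.WeightLE w (H - Q) B := by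
  intro e he
  by_cases h : MvPowerSeries.coeff e H = 0
  · refine hQ e fun h' => he ?_
    rw [map_sub, h, h', sub_zero]
  · exact hH e h

theorem MvPowerSeries.WeightLE.prod {κ : Type*} (s : Finset κ) (F : κ → MvPowerSeries σ ℤ)
    (h : ∀ i ∈ s, MvPowerSeries.WeightLE w (F i) 0) :
    MvPowerSeries.WeightLE w (∏ i ∈ s, F i) 0 := by
  classical
  induction s using Finset.induction_on with
  | empty => simpa using MvPowerSeries.WeightLE.one
  | insert a s ha ih =>
    rw [Finset.prod_insert ha]
    exact (h a (Finset.mem_insert_self _ _)).mul (ih fun i hi => h i (Finset.mem_insert_of_mem hi))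

/-- The numerator is `H` times factors free of the `v`-variables, so it inherits the bound from `H`
whichever denominators were chosen. -/
theorem HasMultiRationalForm.degreeOf_le {p q : ℕ} {H : MvPowerSeries (Fin p ⊕ Fin q) ℤ}
    {f : MvPolynomial (Fin p ⊕ Fin q) ℤ} {s : ℕ} {d : Fin s → Fin p → ℕ}
    (h : HasMultiRationalForm H f d) {j : Fin q} {B : ℕ}
    (hH : MvPowerSeries.WeightLE (Finsupp.applyAddHom (Sum.inr j)) H B) :
    f.degreeOf (Sum.inr j) ≤ B := by
  refine MvPolynomial.degreeOf_le_iff.2 fun e he => ?_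
  have hprod : MvPowerSeries.WeightLE (Finsupp.applyAddHom (Sum.inr j))
      (∏ i, (1 - ∏ k : Fin p, (MvPowerSeries.X (Sum.inl k)) ^ d i k) :
        MvPowerSeries (Fin p ⊕ Fin q) ℤ) 0 := by
    refine .prod _ _ fun i _ => .sub .one (.prod _ _ fun k _ => ?_)
    rw [MvPowerSeries.X_pow_eq]
    exact .monomial (by simp) 1
  have := hH.mul hprod
  rw [h.2] at this
  exact this e (by rw [MvPolynomial.coeff_coe]; exact MvPolynomial.mem_support_iff.1 he)

end DegreeBound

end PowerSeriesForms

/-! ### Change of grading monoid and homogeneous generators. -/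

section Reindexing

variable {K A : Type*} [Field K] [NonUnitalNonAssocRing A] [Module K A]
  {P : ZMod 2 → Submodule K A}

theorem IsSuperalgebraGrading.comp_equiv {ι ι' : Type*} [DecidableEq ι] [AddMonoid ι]
    [DecidableEq ι'] [AddMonoid ι'] {𝒜 : ι → Submodule K A} (h : IsSuperalgebraGrading P 𝒜)
    (φ : ι' ≃+ ι) : IsSuperalgebraGrading P (𝒜 ∘ φ) where
  isInternal := by
    have := (DirectSum.isInternal_submodule_iff_iSupIndep_and_iSup_eq_top 𝒜).1 h.isInternal
    refine (DirectSum.isInternal_submodule_iff_iSupIndep_and_iSup_eq_top _).2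
      ⟨this.1.comp φ.injective, ?_⟩
    rw [← this.2]
    exact φ.toEquiv.iSup_comp (g := 𝒜)
  mul_mem i j x y hx hy := by
    have := h.mul_mem hx hy
    rwa [← map_add] at this
  parity d := h.parity (φ d)

/-- A finitely generated graded algebra is generated by finitely many homogeneous elements. -/
theorem IsAlgGrading.exists_homogeneous_generators [IsScalarTower K A A] [SMulCommClass K A A]
    {ι : Type*} [DecidableEq ι] [Add ι]
    {𝒜 : ι → Submodule K A} (h : IsAlgGrading 𝒜) {S : Set A} (hS : S.Finite)
    (htop : NonUnitalAlgebra.adjoin K S = ⊤) :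
    ∃ (r : ℕ) (a : Fin r → A) (deg : Fin r → ι),
      NonUnitalAlgebra.adjoin K (Set.range a) = ⊤ ∧ ∀ i, a i ∈ 𝒜 (deg i) := by
  classical
  let _ := h.isInternal.chooseDecomposition
  let F : Finset (A × ι) := hS.toFinset.biUnion fun x =>
    (DirectSum.decompose 𝒜 x).support.image fun d => ((DirectSum.decompose 𝒜 x d : A), d)
  refine ⟨F.card, fun i => (F.equivFin.symm i).1.1, fun i => (F.equivFin.symm i).1.2, ?_, ?_⟩
  · rw [eq_top_iff, ← htop]
    refine NonUnitalAlgebra.adjoin_le fun x hx => ?_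
    rw [← DirectSum.sum_support_decompose 𝒜 x]
    refine sum_mem fun d hd => NonUnitalAlgebra.subset_adjoin K ?_
    have hF : ((DirectSum.decompose 𝒜 x d : A), d) ∈ F :=
      Finset.mem_biUnion.2 ⟨x, hS.mem_toFinset.2 hx, Finset.mem_image_of_mem _ hd⟩
    exact ⟨F.equivFin ⟨_, hF⟩, by simp⟩
  · intro i
    obtain ⟨x, _, hx⟩ := Finset.mem_biUnion.1 (F.equivFin.symm i).2
    obtain ⟨d, _, hd⟩ := Finset.mem_image.1 hx
    beta_reduce
    rw [← hd]
    exact (DirectSum.decompose 𝒜 x d).2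

end Reindexing

/-! ### Assembly of the one-variable and the multigraded statements. -/

theorem theorem4p5 {K A : Type*} [Field K] (hK : (2 : K) ≠ 0)
    [NonUnitalNonAssocRing A] [Module K A] [IsScalarTower K A A] [SMulCommClass K A A]
    (P : ZMod 2 → Submodule K A) (hA : IsBicommutativeSuperalgebra P) :
    -- (i)
    (∀ 𝒜 : ℕ → Submodule K A, IsSuperalgebraGrading P 𝒜 →
      (∃ S : Set A, S.Finite ∧ NonUnitalAlgebra.adjoin K S = ⊤) →
        (𝒜 0 = ⊥ → ∀ n, FiniteDimensional K (𝒜 n)) ∧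
        ((∀ n, FiniteDimensional K (𝒜 n)) →
          ∃ (s : ℕ) (d : Fin s → ℕ) (f : Polynomial ℤ),
            HasRationalForm (hilbertSeries 𝒜) f d)) ∧
    -- (ii)
    (∀ (p q : ℕ) (𝒜 : ((Fin p ⊕ Fin q) →₀ ℕ) → Submodule K A), IsSuperalgebraGrading P 𝒜 →
      ∀ (r : ℕ) (a : Fin r → A) (deg : Fin r → ((Fin p ⊕ Fin q) →₀ ℕ)),
        NonUnitalAlgebra.adjoin K (Set.range a) = ⊤ →
        (∀ i, a i ∈ 𝒜 (deg i)) →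
        (∀ i, (∃ j : Fin q, deg i (Sum.inr j) ≠ 0) → a i ∈ P 1) →
          (𝒜 0 = ⊥ → ∀ e, FiniteDimensional K (𝒜 e)) ∧
          ((∀ e, FiniteDimensional K (𝒜 e)) →
            (∃ (s : ℕ) (d : Fin s → (Fin p → ℕ)) (f : MvPolynomial (Fin p ⊕ Fin q) ℤ),
              HasMultiRationalForm (multiHilbertSeries 𝒜) f d) ∧
            (∀ (s : ℕ) (d : Fin s → (Fin p → ℕ)) (f : MvPolynomial (Fin p ⊕ Fin q) ℤ),
              HasMultiRationalForm (multiHilbertSeries 𝒜) f d →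
                ∀ j : Fin q, f.degreeOf (Sum.inr j) ≤ 2 * ∑ i, deg i (Sum.inr j)))) := by
  constructor
  · rintro 𝒜 h𝒜 ⟨S, hS, hStop⟩
    let φ : (Unit →₀ ℕ) ≃+ ℕ := Finsupp.uniqueAddEquiv ()
    obtain ⟨r, a, deg, htop, hdeg⟩ := h𝒜.exists_homogeneous_generators hS hStop
    -- With the trivial predicate every nonzero degree may occur in the denominator, and no
    -- generator is required to be odd.
    obtain ⟨h1, h2, -⟩ := hA.hilbertSeries_of_generators hK (h𝒜.comp_equiv φ) a (φ.symm ∘ deg)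
      htop (fun i => by simpa using hdeg i) (fun _ => True) (fun i hi => (hi trivial).elim)
    have hφ (n : ℕ) : 𝒜 n = (𝒜 ∘ φ) (φ.symm n) := by simp
    refine ⟨fun h0 n => ?_, fun hfin => ?_⟩
    · rw [hφ n]
      exact h1 (by simpa using h0) _
    · obtain ⟨s, d, hd, hpoly⟩ := h2 fun e => hfin _
      obtain ⟨f, hf⟩ := hpoly.exists_polynomial
      refine ⟨s, fun i => d i (), f, fun i => Nat.one_le_iff_ne_zero.2 fun h => (hd i).1 ?_, ?_⟩
      · ext
        exact h
      · rw [hf]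
        have hH : hilbertSeries 𝒜 = subspaceHilbertSeries (𝒜 ∘ φ) ⊤ := by
          ext n
          rw [hilbertSeries, PowerSeries.coeff_mk, PowerSeries.coeff, coeff_subspaceHilbertSeries,
            top_inf_eq, Function.comp_apply, show φ (Finsupp.single () n) = n by simp [φ]]
        rw [hH]
        congr 1
        refine Finset.prod_congr rfl fun i _ => ?_
        rw [PowerSeries.X_pow_eq, PowerSeries.monomial, ← Finsupp.unique_single (d i)]
  · intro p q 𝒜 h𝒜 r a deg htop hdeg hodd
    -- The predicate says that a degree involves no `v`-variable. It confines denominators to the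
    -- `u`-variables and makes each `v_j`-exponent a weight to which the bound `h3` applies.
    obtain ⟨h1, h2, h3⟩ := hA.hilbertSeries_of_generators hK h𝒜 a deg htop hdeg
      (fun e => ∀ j, e (Sum.inr j) = 0) (fun i hi => hodd i (not_forall.1 hi))
    have hH : multiHilbertSeries 𝒜 = subspaceHilbertSeries 𝒜 ⊤ := by
      ext e
      rw [coeff_subspaceHilbertSeries, top_inf_eq]
      rfl
    refine ⟨h1, fun hfin => ⟨?_, fun s d f hf j => hf.degreeOf_le fun e he => ?_⟩⟩
    · obtain ⟨s, d, hd, f, hf⟩ := h2 hfin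
      refine ⟨s, fun i k => d i (Sum.inl k), f, fun i h => (hd i).1 ?_, ?_⟩
      · ext (k | j)
        · exact congrFun h k
        · exact (hd i).2 j
      · rw [hf, hH]
        congr 1
        exact Finset.prod_congr rfl fun i _ => by
          rw [MvPowerSeries.monomial_eq_prod_X_inl (hd i).2]
    · refine h3 (Finsupp.applyAddHom (Sum.inr j)) (fun e he => he j) e fun hbot => he ?_
      rw [hH, coeff_subspaceHilbertSeries, hbot, inf_bot_eq, finrank_bot]
      rfl
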